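/- For $\beta\in\mathbb R^p$ and a symmetric positive semidefinite $\Sigma\in\mathbb R^{p\times p}$, let $P_{\beta,\Sigma}$ be the law of $(X,Y)\in\mathbb R^{p}\times\mathbb R$ with $X\sim\mathcal N(0,\Sigma)$ and $Y\mid X\sim\mathcal N(X^{T}\beta,1)$. For $B_2>0$ let $$\Theta=\{(\beta,\Sigma):\ \|\beta\|_2\le B_1,\ \Sigma\succeq 0,\ \lambda_{\min}(\Sigma)\ge B_2,\ \|\Sigma\|_2\le B_3\},$$ where $\|\Sigma\|_2$ is the spectral norm. Let $\sigma(u)=1/(1+e^{-u})$ and $\mathrm{ReLU}(u)=\max(u,0)$, and let $d^{(1)},d^{(2)},\dots\ge 1$ be layer widths. Define classes of functions on $\mathbb R^{p+1}$ by $$\mathcal D^{(1)}=\{x\mapsto\sigma(w^{T}x+b):\ \|w\|_2\le B,\ b\in\mathbb R\},$$ $$\mathcal D^{(l+1)}=\Big\{\mathrm{ReLU}\Big(\sum_{i=1}^{d^{(l)}}w_if_i\Big):\ \sum_{i}|w_i|\le 1,\ f_i\in\mathcal D^{(l)}\Big\},$$ and $$\mathcal D(B,L)=\Big\{\sum_{i=1}^{d^{(L-1)}}w_if_i:\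 \sum_i|w_i|\le 1,\ f_i\in\mathcal D^{(L-1)}\Big\}\quad\text{for } L\ge 2,\qquad \mathcal D(B,1)=\mathcal D^{(1)}.$$ Let $W(P,Q)$ denote the order-one Wasserstein distance on $\mathbb R^{p+1}$ with respect to the Euclidean norm, i.e. the infimum of $\mathbb E\|U-V\|_2$ over all couplings $(U,V)$ of $P$ and $Q$. There is a constant $c>0$ such that for all $B_1$, $B_2>0$ and $B_3$ there is a constant $C>0$, depending only on $B_1,B_2,B_3$, for which the following holds. Let $p\ge 0$, $n\ge 1$, $L\ge 1$ be integers, let the widths $d^{(l)}\ge1$ be arbitrary, and let $\epsilon\ge 0$ satisfy $$2^{L}\,\frac pn+\epsilon^{2}\le c .$$ Let $(\beta^*,\Sigma^*)\in S\subseteq\Theta$, where $S$ is the set of candidate parameters (for instance $S=\Theta$, or $S=\{(\beta,\Sigma)\in\Theta:\Sigma=\Sigma^*\}$ when $\Sigma^*$ is known). Let $P$ be a probability measure on $\mathbb R^{p+1}$ with $W(P,P_{\beta^*,\Sigma^*})\le\epsilon$, let $(X_1,Y_1),\dots,(X_n,Y_n)$ be i.i.d. from $P$, with empirical distribution $P_n$,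 and let $$(\widehat\beta,\widehat\Sigma)\in\operatorname*{arg\,min}_{(\beta,\Sigma)\in S}\ \sup_{f\in\mathcal D(B_1+1,L)}\big\{\mathbb E_{P_n}f-\mathbb E_{P_{\beta,\Sigma}}f\big\}$$ be any minimizer (the W-GAN estimator). Then $$\|\beta^*-\widehat\beta\|_2^2\ \le\ C\Big(2^{L}\sqrt{\tfrac pn}\ \vee\ \epsilon\Big)$$ with probability at least $1-e^{-(p+n\epsilon^2)}$. -/

import Mathlib

open MeasureTheory ProbabilityTheory
open scoped ENNReal

namespace WGAN

/-- The observation space `ℝ^p × ℝ` of pairs `(x, y)`, with the Euclidean (`ℓ²`) norm of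
`ℝ^(p+1)`. -/
abbrev Obs (p : ℕ) : Type := WithLp 2 (EuclideanSpace ℝ (Fin p) × ℝ)

/-- A parameter of the regression model: a coefficient vector `β` and a covariance matrix `Σ`. -/
abbrev Param (p : ℕ) : Type := EuclideanSpace ℝ (Fin p) × Matrix (Fin p) (Fin p) ℝ

/-- The Wasserstein distance of order one:
the infimum of `E ‖U - V‖` over all couplings of `P` and `Q`. -/
noncomputable def wasserstein {E : Type*} [PseudoEMetricSpace E] [MeasurableSpace E]
    (P Q : Measure E) : ℝ≥0∞ :=
  ⨅ (π : Measure (E × E)) (_ : π.map Prod.fst = P) (_ : π.map Prod.snd = Q),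
    ∫⁻ z, edist z.1 z.2 ∂π

/-- The joint law of `(X, Y)` in the Gaussian linear model: `X ∼ N(0, Σ)` and, given `X`,
`Y ∼ N(⟨X, β⟩, 1)`, that is, `Y = ⟨X, β⟩ + ξ` with `ξ ∼ N(0, 1)` independent of `X`. -/
noncomputable def modelLaw {p : ℕ} (θ : Param p) : Measure (Obs p) :=
  ((multivariateGaussian 0 θ.2).prod (gaussianReal 0 1)).map
    fun z => WithLp.toLp 2 (z.1, inner ℝ z.1 θ.1 + z.2)

/-- The parameter space: `‖β‖₂ ≤ B₁`, and `Σ` is a positive semidefinite (in particular symmetric)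
matrix with smallest eigenvalue at least `B₂` and spectral norm at most `B₃`. -/
def paramSpace (p : ℕ) (B₁ B₂ B₃ : ℝ) : Set (Param p) :=
  {θ | ‖θ.1‖ ≤ B₁ ∧ θ.2.PosSemidef ∧ (θ.2 - B₂ • (1 : Matrix (Fin p) (Fin p) ℝ)).PosSemidef ∧
    ‖Matrix.toEuclideanCLM (𝕜 := ℝ) θ.2‖ ≤ B₃}

section Network

variable {E : Type*} [NormedAddCommGroup E] [InnerProductSpace ℝ E]

/-- Functions computed by a node of the first layer: `x ↦ σ(⟨w, x⟩ + b)` with `‖w‖₂ ≤ B`, where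
`σ` is the sigmoid function. -/
def firstLayer (E : Type*) [NormedAddCommGroup E] [InnerProductSpace ℝ E] (B : ℝ) :
    Set (E → ℝ) :=
  {f | ∃ (w : E) (b : ℝ), ‖w‖ ≤ B ∧ f = fun x => Real.sigmoid (inner ℝ w x + b)}

/-- Linear combinations of `k` functions of the class `F`, with coefficients whose absolute values
sum to at most one. -/
def lOneComb (k : ℕ) (F : Set (E → ℝ)) : Set (E → ℝ) :=
  {f | ∃ (w : Fin k → ℝ) (g : Fin k → E → ℝ), ∑ i, |w i| ≤ 1 ∧ (∀ i, g i ∈ F) ∧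
    f = fun x => ∑ i, w i * g i x}

/-- `hiddenLayer E B d l` is the class of functions computed by a node of layer `l + 1`: sigmoid
nodes in layer `1`, and ReLU nodes in the later layers. The number of nodes of layer `j` is
`d j`. -/
def hiddenLayer (E : Type*) [NormedAddCommGroup E] [InnerProductSpace ℝ E] (B : ℝ) (d : ℕ → ℕ) :
    ℕ → Set (E → ℝ)
  | 0 => firstLayer E B
  | l + 1 => {f | ∃ g ∈ lOneComb (d (l + 1)) (hiddenLayer E B d l), f = fun x => max (g x) 0}

/-- The discriminator class `𝒟(B, L)` of networks with `L` layers, the last one being linear.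
For `L = 1` there are no layers above the sigmoid nodes, and the class consists of these
(the value at `L = 0` plays no role). -/
def discriminator (E : Type*) [NormedAddCommGroup E] [InnerProductSpace ℝ E] (B : ℝ) (d : ℕ → ℕ) :
    ℕ → Set (E → ℝ)
  | 0 => ∅
  | 1 => firstLayer E B
  | l + 2 => lOneComb (d (l + 1)) (hiddenLayer E B d l)

end Network

/-- The objective of the W-GAN model for the sample `z`:
`sup_{f ∈ D} (E_{P_n} f - E_Q f)`, with `P_n` the empirical distribution of `z`. -/
noncomputable def objective {E : Type*} [MeasurableSpace E] (D : Set (E → ℝ)) {n : ℕ}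
    (z : Fin n → E) (Q : Measure E) : ℝ :=
  ⨆ f : D, ((∑ i, (f : E → ℝ) (z i)) / n - ∫ x, (f : E → ℝ) x ∂Q)

/-- `θ` is a value of the W-GAN estimator at the sample `z`, with discriminator class `D`: it
minimizes the objective over the set `S` of candidate parameters. -/
def IsEstimate {p n : ℕ} (D : Set (Obs p → ℝ)) (S : Set (Param p)) (z : Fin n → Obs p)
    (θ : Param p) : Prop :=
  θ ∈ S ∧ ∀ θ' ∈ S, objective D z (modelLaw θ) ≤ objective D z (modelLaw θ')

end WGAN

namespace WGAN

/-! ### Nets in balls and in the line -/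

/-! Optimality of the estimator turns a one-sided uniform deviation bound into a statement about
model laws. Suppose `P_n f - Q f ≤ t` for all discriminators `f`, where `Q` is the true model law.
Then the minimal objective is at most `t`. Since the class is stable under `f ↦ c - f`, the means of
every `f` under the fitted and the true law differ by at most `2t`
(`sub_integral_le_of_isEstimate`).

A single sigmoid node then detects `β`. On the residual `Y - Xᵀβ*` the true law is `N(0, 1)`, while
a model with parameters `(β, Σ)` gives `N(0, 1 + q)` with `q = (β - β*)ᵀ Σ (β - β*) ≥ B₂ ‖β - β*‖²`.
The mean of `σ(u - 1)` grows at least linearly in `q` on a bounded range, the bias being needed to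
break the symmetry of `σ` (`exists_firstLayer_separation`). Hence `‖β - β*‖²`, not its root, is of
the order of `t`.

For the deviation, the contaminated sample is coupled with an i.i.d. sample from `Q`. Discriminators
are bounded by `1` and Lipschitz, so exchanging the samples costs a sum of transport costs truncated
at `2`, controlled by a Chernoff bound from the first moment alone (`measure_truncated_cost_le`).
The sample from `Q` is subgaussian and is treated by exponential moments: symmetrization, then
peeling of the layers, then chaining over sigmoid nodes. Each ReLU contracts at no cost and each
`ℓ¹` combination doubles the exponential moment, so depth contributes only a factor `2 ^ L` in front
of the exponential, whatever the widths. -/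

/-- A 1-separated subset of the ball of radius 2 with the largest cardinality is a net; the
Besicovitch volume count bounds its size. -/
theorem exists_unit_net (E : Type*) [NormedAddCommGroup E] [NormedSpace ℝ E]
    [FiniteDimensional ℝ E] :
    ∃ A : Finset E, A.card ≤ 5 ^ Module.finrank ℝ E ∧ ∀ w : E, ‖w‖ ≤ 2 → ∃ a ∈ A, ‖w - a‖ ≤ 1 := by
  classical
  let T : Set ℕ := {k | ∃ s : Finset E, s.card = k ∧ (∀ c ∈ s, ‖c‖ ≤ 2) ∧
    ∀ c ∈ s, ∀ d ∈ s, c ≠ d → 1 ≤ ‖c - d‖}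
  have hbdd : BddAbove T := by
    refine ⟨5 ^ Module.finrank ℝ E, ?_⟩
    rintro _ ⟨s, rfl, h⟩
    exact Besicovitch.card_le_of_separated s h.1 h.2
  have hne : T.Nonempty := ⟨0, ∅, by simp⟩
  obtain ⟨A, hA, hA2, hsep⟩ := Nat.sSup_mem hne hbdd
  refine ⟨A, Besicovitch.card_le_of_separated A hA2 hsep, fun w hw => ?_⟩
  by_contra! hcon
  have hwA : w ∉ A := fun h => by simpa using (hcon w h).trans' zero_lt_one
  have hmem : A.card + 1 ∈ T := by
    refine ⟨insert w A, Finset.card_insert_of_notMem hwA, ?_, ?_⟩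
    · intro c hc
      rcases Finset.mem_insert.1 hc with rfl | hc
      exacts [hw, hA2 c hc]
    · intro c hc d hd hcd
      rcases Finset.mem_insert.1 hc with hc | hc <;> rcases Finset.mem_insert.1 hd with hd | hd
      · exact absurd (hc.trans hd.symm) hcd
      · rw [hc]; exact (hcon d hd).le
      · rw [norm_sub_rev, hd]; exact (hcon c hc).le
      · exact hsep c hc d hd hcd
  have := le_csSup hbdd hmem
  omega

/-- Halving the scale means adding to each centre a rescaled unit net, so each step multiplies the
size by at most `5 ^ finrank`. -/
theorem exists_ball_net (E : Type*) [NormedAddCommGroup E] [NormedSpace ℝ E]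
    [FiniteDimensional ℝ E] {R : ℝ} (hR : 0 < R) (j : ℕ) :
    ∃ A : Finset E, A.card ≤ (5 ^ Module.finrank ℝ E) ^ j ∧
      ∀ w : E, ‖w‖ ≤ R → ∃ a ∈ A, ‖w - a‖ ≤ R / 2 ^ j := by
  classical
  obtain ⟨U, hU, hnet⟩ := exists_unit_net E
  induction j with
  | zero => exact ⟨{0}, by simp, fun w hw => ⟨0, by simp, by simpa using hw⟩⟩
  | succ j ih =>
    obtain ⟨A, hA, hAn⟩ := ih
    refine ⟨Finset.image₂ (fun a u => a + (R / 2 ^ (j + 1)) • u) A U, ?_, fun w hw => ?_⟩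
    · exact (Finset.card_image₂_le _ _ _).trans (by rw [pow_succ]; gcongr)
    · obtain ⟨a, ha, hwa⟩ := hAn w hw
      set r := R / 2 ^ (j + 1) with hr
      have hrpos : 0 < r := by positivity
      have h2r : R / 2 ^ j = 2 * r := by rw [hr, pow_succ]; field_simp
      obtain ⟨u, hu, hwu⟩ := hnet (r⁻¹ • (w - a)) (by
        rw [norm_smul, norm_inv, Real.norm_of_nonneg hrpos.le, inv_mul_le_iff₀ hrpos]
        linarith)
      refine ⟨_, Finset.mem_image₂_of_mem ha hu, ?_⟩
      have : w - (a + r • u) = r • (r⁻¹ • (w - a) - u) := by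
        rw [smul_sub, smul_inv_smul₀ hrpos.ne']; abel
      rw [this, norm_smul, Real.norm_of_nonneg hrpos.le]
      nlinarith

/-- A finite grid of biases, at resolution `2⁻ʲ` in `[-2ʲ, 2ʲ]`. -/
noncomputable def biasGrid (j : ℕ) : Finset ℝ :=
  (Finset.Icc (-(4 : ℤ) ^ j) (4 ^ j)).image fun k : ℤ => (k : ℝ) / 2 ^ j

theorem card_biasGrid_le (j : ℕ) : (biasGrid j).card ≤ 3 * 4 ^ j := by
  refine Finset.card_image_le.trans ?_
  rw [Int.card_Icc]
  have : (1 : ℤ) ≤ 4 ^ j := one_le_pow₀ (by norm_num)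
  have h2 : ((4 ^ j : ℕ) : ℤ) = 4 ^ j := by push_cast; rfl
  omega

theorem abs_sigmoid_sub_le (x y : ℝ) : |Real.sigmoid x - Real.sigmoid y| ≤ |x - y| := by
  have h := Convex.norm_image_sub_le_of_norm_deriv_le (f := Real.sigmoid) (C := 1) (s := Set.univ)
    (fun x _ => differentiableAt_sigmoid) (fun x _ => by
      rw [Real.deriv_sigmoid]
      have h0 := Real.sigmoid_nonneg x
      have h1 := Real.sigmoid_le_one x
      rw [Real.norm_eq_abs, abs_le]; constructor <;> nlinarith) convex_univ
    (Set.mem_univ y) (Set.mem_univ x)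
  simpa using h

theorem one_sub_sigmoid_le {t R : ℝ} (hR : 0 < R) : 1 - Real.sigmoid (t + R) ≤ 2 * (1 + |t|) / R := by
  rw [le_div_iff₀ hR]
  have h0 := Real.sigmoid_nonneg (t + R)
  have h1 := Real.sigmoid_le_one (t + R)
  rcases le_or_gt (R / 2) |t| with h | h
  · nlinarith [abs_nonneg t]
  · have hx : 0 < t + R - R / 2 := by linarith [neg_abs_le t]
    have hs : 1 - Real.sigmoid (t + R) = (1 + Real.exp (t + R))⁻¹ := by
      rw [← Real.sigmoid_neg, Real.sigmoid_def, neg_neg]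
    have he := Real.add_one_le_exp (t + R)
    have hpos : 0 < 1 + Real.exp (t + R) := by positivity
    rw [hs, inv_mul_le_iff₀ hpos]
    nlinarith [abs_nonneg t, mul_nonneg hpos.le (abs_nonneg t)]

/-- The biases range over the whole line, yet finitely many suffice. Beyond `±2 ^ j` the sigmoid is
nearly saturated unless `|t|` is itself of order `2 ^ j`, and there the factor `1 + |t|` makes the
bound trivial. That factor is harmless later because `t` will be a subgaussian linear functional. -/
theorem exists_mem_biasGrid (j : ℕ) (b : ℝ) :
    ∃ b' ∈ biasGrid j, ∀ t : ℝ,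
      |Real.sigmoid (t + b) - Real.sigmoid (t + b')| ≤ 2 * (1 + |t|) / 2 ^ j := by
  have h2 : (0 : ℝ) < 2 ^ j := by positivity
  have h4 : (4 : ℝ) ^ j = 2 ^ j * 2 ^ j := by rw [← mul_pow]; norm_num
  have key : ∀ (R t b : ℝ), 0 < R → R ≤ b →
      |Real.sigmoid (t + b) - Real.sigmoid (t + R)| ≤ 2 * (1 + |t|) / R := by
    intro R t b hR hb
    have h1 := Real.sigmoid_le_one (t + b)
    have hm := Real.sigmoid_monotone (show t + R ≤ t + b by linarith)
    rw [abs_of_nonneg (by linarith)]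
    linarith [one_sub_sigmoid_le (t := t) hR]
  have hgrid : (2 : ℝ) ^ j = ((4 ^ j : ℤ) : ℝ) / 2 ^ j := by
    push_cast; rw [h4]; field_simp
  have hpow : (0 : ℤ) < 4 ^ j := by positivity
  rcases le_or_gt ((2 : ℝ) ^ j) b with hb | hb
  · refine ⟨2 ^ j, ?_, fun t => key _ t b h2 hb⟩
    exact Finset.mem_image.2 ⟨4 ^ j, by simp, hgrid.symm⟩
  rcases le_or_gt b (-(2 : ℝ) ^ j) with hb' | hb'
  · refine ⟨-2 ^ j, ?_, fun t => ?_⟩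
    · refine Finset.mem_image.2 ⟨-4 ^ j, by simp, ?_⟩
      push_cast; rw [h4]; field_simp
    · have := key _ (-t) (-b) h2 (by linarith)
      rw [show -t + -b = -(t + b) by ring, show -t + 2 ^ j = -(t + -2 ^ j) by ring,
        Real.sigmoid_neg, Real.sigmoid_neg, abs_neg, abs_sub_comm] at this
      convert this using 2; ring
  · refine ⟨(⌊b * 2 ^ j⌋ : ℝ) / 2 ^ j, ?_, fun t => ?_⟩
    · refine Finset.mem_image.2 ⟨⌊b * 2 ^ j⌋, ?_, rfl⟩
      rw [Finset.mem_Icc]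
      constructor
      · rw [Int.le_floor]; push_cast; rw [h4]; nlinarith
      · have : (⌊b * 2 ^ j⌋ : ℝ) ≤ ((4 ^ j : ℤ) : ℝ) := by
          push_cast; rw [h4]; exact (Int.floor_le _).trans (by nlinarith)
        exact_mod_cast this
    · refine (abs_sigmoid_sub_le _ _).trans ?_
      have hfl := Int.floor_le (b * 2 ^ j)
      have hfl' := Int.lt_floor_add_one (b * 2 ^ j)
      have : t + b - (t + (⌊b * 2 ^ j⌋ : ℝ) / 2 ^ j) = (b * 2 ^ j - ⌊b * 2 ^ j⌋) / 2 ^ j := by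
        field_simp; ring
      rw [this, abs_div, abs_of_pos h2, abs_of_nonneg (by linarith)]
      gcongr
      linarith [abs_nonneg t]

/-! ### Elementary properties of the discriminator classes -/

section Discriminator

theorem const_mul_mem_lOneComb {E : Type*} {k : ℕ} (hk : 0 < k) {F : Set (E → ℝ)} {f : E → ℝ}
    (hf : f ∈ F) {c : ℝ} (hc : |c| ≤ 1) : (fun x => c * f x) ∈ lOneComb k F := by
  classical
  refine ⟨fun i => if i = ⟨0, hk⟩ then c else 0, fun _ => f, ?_, fun _ => hf, ?_⟩
  · simpa [apply_ite abs] using hc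
  · funext x; simp

theorem lOneComb_bound {E : Type*} [NormedAddCommGroup E] {k : ℕ} {F : Set (E → ℝ)} {B : ℝ} (hB : 0 ≤ B)
    (hF : ∀ f ∈ F, (∀ x, |f x| ≤ 1) ∧ ∀ x y, |f x - f y| ≤ B * ‖x - y‖) :
    ∀ f ∈ lOneComb k F, (∀ x, |f x| ≤ 1) ∧ ∀ x y, |f x - f y| ≤ B * ‖x - y‖ := by
  rintro _ ⟨w, g, hw, hg, rfl⟩
  have key : ∀ (v : Fin k → ℝ) (C : ℝ), 0 ≤ C → (∀ i, |v i| ≤ C) → |∑ i, w i * v i| ≤ C := by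
    intro v C hC hv
    calc |∑ i, w i * v i| ≤ ∑ i, |w i * v i| := Finset.abs_sum_le_sum_abs _ _
      _ ≤ ∑ i, |w i| * C := by
        refine Finset.sum_le_sum fun i _ => ?_
        rw [abs_mul]; exact mul_le_mul_of_nonneg_left (hv i) (abs_nonneg _)
      _ = (∑ i, |w i|) * C := (Finset.sum_mul ..).symm
      _ ≤ C := mul_le_of_le_one_left hC hw
  refine ⟨fun x => key _ 1 zero_le_one fun i => (hF _ (hg i)).1 x, fun x y => ?_⟩
  simp only [← Finset.sum_sub_distrib, ← mul_sub]
  exact key _ _ (by positivity) fun i => (hF _ (hg i)).2 x y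

variable {E : Type*} [NormedAddCommGroup E] [InnerProductSpace ℝ E]

/-- Sigmoids are nonnegative, so a ReLU passes them unchanged and one weight equal to `1` carries a
node through any depth. -/
theorem firstLayer_subset_hiddenLayer {B : ℝ} {d : ℕ → ℕ} (hd : ∀ j, 0 < d j) (l : ℕ) :
    firstLayer E B ⊆ hiddenLayer E B d l := by
  induction l with
  | zero => exact subset_rfl
  | succ l ih =>
    intro f hf
    refine ⟨_, const_mul_mem_lOneComb (hd _) (ih hf) (c := 1) (by simp), ?_⟩
    obtain ⟨w, b, -, rfl⟩ := hf
    funext x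
    simp [Real.sigmoid_nonneg]

theorem firstLayer_nonempty {B : ℝ} (hB : 0 ≤ B) : (firstLayer E B).Nonempty :=
  ⟨_, 0, 0, by simpa using hB, rfl⟩

theorem firstLayer_subset_discriminator {B : ℝ} {d : ℕ → ℕ} (hd : ∀ j, 0 < d j) {L : ℕ}
    (hL : 1 ≤ L) : firstLayer E B ⊆ discriminator E B d L := by
  match L, hL with
  | 1, _ => exact subset_rfl
  | l + 2, _ =>
    intro f hf
    simpa using! const_mul_mem_lOneComb (hd (l + 1))
      (firstLayer_subset_hiddenLayer hd l hf) (c := 1) (by simp)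

/-- Every discriminator class is invariant under a reflection `f ↦ c - f`. -/
theorem exists_const_sub_mem_discriminator {B : ℝ} {d : ℕ → ℕ} {L : ℕ} {f : E → ℝ}
    (hf : f ∈ discriminator E B d L) :
    ∃ c : ℝ, (fun x => c - f x) ∈ discriminator E B d L := by
  match L, hf with
  | 1, hf =>
    obtain ⟨w, b, hw, rfl⟩ := hf
    refine ⟨1, -w, -b, by simpa using hw, ?_⟩
    funext x
    rw [← Real.sigmoid_neg, inner_neg_left, neg_add]
  | l + 2, hf =>
    obtain ⟨w, g, hw, hg, rfl⟩ := hf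
    exact ⟨0, fun i => -w i, g, by simpa using hw, hg, by funext x; simp⟩

theorem hiddenLayer_bound {B : ℝ} (hB : 0 ≤ B) {d : ℕ → ℕ} (l : ℕ) :
    ∀ f ∈ hiddenLayer E B d l, (∀ x, |f x| ≤ 1) ∧ ∀ x y, |f x - f y| ≤ B * ‖x - y‖ := by
  induction l with
  | zero =>
    rintro _ ⟨w, b, hw, rfl⟩
    refine ⟨fun x => ?_, fun x y => ?_⟩
    · rw [abs_of_nonneg (Real.sigmoid_nonneg _)]; exact Real.sigmoid_le_one _
    · refine (abs_sigmoid_sub_le _ _).trans ?_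
      rw [add_sub_add_right_eq_sub, ← inner_sub_right]
      exact (abs_real_inner_le_norm _ _).trans (by gcongr)
  | succ l ih =>
    rintro _ ⟨g, hg, rfl⟩
    have h := lOneComb_bound hB ih g hg
    refine ⟨fun x => ?_, fun x y => ?_⟩
    · have := h.1 x
      rw [abs_le] at this ⊢
      exact ⟨by linarith [le_max_right (g x) 0], max_le this.2 zero_le_one⟩
    · exact (abs_max_sub_max_le_abs _ _ _).trans (h.2 x y)

theorem discriminator_bound {B : ℝ} (hB : 0 ≤ B) {d : ℕ → ℕ} {L : ℕ} :
    ∀ f ∈ discriminator E B d L, (∀ x, |f x| ≤ 1) ∧ ∀ x y, |f x - f y| ≤ B * ‖x - y‖ := by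
  match L with
  | 0 => exact fun f hf => hf.elim
  | 1 => exact hiddenLayer_bound hB (d := d) 0
  | l + 2 => exact lOneComb_bound hB (hiddenLayer_bound hB l)

theorem continuous_of_mem_discriminator {B : ℝ} (hB : 0 ≤ B) {d : ℕ → ℕ} {L : ℕ} {f : E → ℝ}
    (hf : f ∈ discriminator E B d L) : Continuous f :=
  (LipschitzWith.of_dist_le_mul (K := ⟨B, hB⟩) fun x y => by
    rw [Real.dist_eq, dist_eq_norm]; exact (discriminator_bound hB f hf).2 x y).continuous

end Discriminator

/-! ### Exponential Rademacher averages -/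

/-- The sum `∑ i, eᵢ tᵢ` for a vector of signs `e`. -/
def signedSum {ι : Type*} [Fintype ι] (e : ι → ℤˣ) (t : ι → ℝ) : ℝ := ∑ i, ((e i : ℤ) : ℝ) * t i

theorem signedSum_neg {ι : Type*} [Fintype ι] (e : ι → ℤˣ) (t : ι → ℝ) : signedSum (-e) t = -signedSum e t := by
  simp [signedSum]

/-- The sum over all sign vectors `e` of `sup_{f ∈ F} exp (lam * ∑ i, eᵢ f(uᵢ))`. -/
noncomputable def rademacherExp {ι : Type*} [Fintype ι] [DecidableEq ι] {E : Type*} (lam : ℝ)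
    (F : Set (E → ℝ)) (u : ι → E) : ℝ≥0∞ :=
  ∑ e : ι → ℤˣ, ⨆ f : F, ENNReal.ofReal (Real.exp (lam * signedSum e fun i => (f : E → ℝ) (u i)))

/-- Two-point form of the contraction principle. The second alternative on the right interchanges
the signs of the two points, which a sum of suprema over both signs absorbs. -/
theorem exp_relu_add_exp_relu_le (a b s t : ℝ) :
    Real.exp (a + max s 0) + Real.exp (b - max t 0) ≤
      max (Real.exp (a + s) + Real.exp (b - t)) (Real.exp (a - s) + Real.exp (b + t)) := by
  rcases le_total 0 s with hs | hs <;> rcases le_total 0 t with ht | ht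
  · rw [max_eq_left hs, max_eq_left ht]; exact le_max_left _ _
  · rw [max_eq_left hs, max_eq_right ht]
    refine le_max_of_le_left ?_
    gcongr
  · rw [max_eq_right hs, max_eq_left ht]
    refine le_max_of_le_right ?_
    gcongr <;> linarith
  · rw [max_eq_right hs, max_eq_right ht, add_zero, sub_zero]
    -- The two alternatives add up to at least `2 * exp a + 2 * exp b` by `cosh ≥ 1`, so both cannot
    -- be smaller than `exp a + exp b`.
    by_contra! hcon
    obtain ⟨h1, h2⟩ := max_lt_iff.1 hcon
    have key : ∀ c x : ℝ, 2 * Real.exp c ≤ Real.exp (c + x) + Real.exp (c - x) := by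
      intro c x
      have h := Real.one_le_cosh x
      rw [Real.cosh_eq] at h
      have hc := Real.exp_pos c
      rw [sub_eq_add_neg, Real.exp_add, Real.exp_add]
      nlinarith
    linarith [key a s, key b t]

theorem iSup_exp_relu_add_le {κ : Type*} (A x : κ → ℝ) :
    (⨆ g, ENNReal.ofReal (Real.exp (A g + max (x g) 0))) +
      (⨆ g, ENNReal.ofReal (Real.exp (A g - max (x g) 0))) ≤
    (⨆ g, ENNReal.ofReal (Real.exp (A g + x g))) + ⨆ g, ENNReal.ofReal (Real.exp (A g - x g)) := by
  rcases isEmpty_or_nonempty κ with h | h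
  · simp
  refine ENNReal.iSup_add_iSup_le fun g k => ?_
  rw [← ENNReal.ofReal_add (Real.exp_pos _).le (Real.exp_pos _).le]
  refine (ENNReal.ofReal_le_ofReal (exp_relu_add_exp_relu_le _ _ _ _)).trans ?_
  rw [ENNReal.ofReal_max]
  refine max_le ?_ ?_ <;> rw [ENNReal.ofReal_add (Real.exp_pos _).le (Real.exp_pos _).le]
  · exact add_le_add (le_iSup (fun g => ENNReal.ofReal (Real.exp (A g + x g))) g)
      (le_iSup (fun g => ENNReal.ofReal (Real.exp (A g - x g))) k)
  · rw [add_comm]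
    exact add_le_add (le_iSup (fun g => ENNReal.ofReal (Real.exp (A g + x g))) k)
      (le_iSup (fun g => ENNReal.ofReal (Real.exp (A g - x g))) g)

section Rademacher

variable {ι : Type*} [Fintype ι] [DecidableEq ι] {E : Type*}

theorem signedSum_eq_add (e : ι → ℤˣ) (t : ι → ℝ) (i : ι) :
    signedSum e t = (∑ k ∈ Finset.univ.erase i, ((e k : ℤ) : ℝ) * t k) + ((e i : ℤ) : ℝ) * t i := by
  rw [signedSum, add_comm]
  exact (Finset.add_sum_erase Finset.univ (fun k => ((e k : ℤ) : ℝ) * t k) (Finset.mem_univ i)).symm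

theorem sum_comp_relu_coordinate_le {κ : Type*} {lam : ℝ} (hlam : 0 ≤ lam) (t t' : κ → ι → ℝ)
    (i : ι) (hi : ∀ g, t' g i = max (t g i) 0) (hne : ∀ g, ∀ k ≠ i, t' g k = t g k) :
    ∑ e : ι → ℤˣ, ⨆ g, ENNReal.ofReal (Real.exp (lam * signedSum e (t' g))) ≤
      ∑ e : ι → ℤˣ, ⨆ g, ENNReal.ofReal (Real.exp (lam * signedSum e (t g))) := by
  let flip : (ι → ℤˣ) ≃ (ι → ℤˣ) := Equiv.mulRight (Pi.mulSingle i (-1))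
  have hflip_i : ∀ e : ι → ℤˣ, flip e i = -e i := fun e => by simp [flip]
  have hflip_ne : ∀ e : ι → ℤˣ, ∀ k ≠ i, flip e k = e k := fun e k hk => by simp [flip, hk]
  have hdouble : ∀ G : (ι → ℤˣ) → ℝ≥0∞, ∑ e, (G e + G (flip e)) = 2 * ∑ e, G e := fun G => by
    rw [Finset.sum_add_distrib, Equiv.sum_comp flip G, two_mul]
  -- Doubling both sides lets each sign vector be paired with its flip at `i`; each pair is an
  -- instance of `iSup_exp_relu_add_le`.
  rw [← ENNReal.mul_le_mul_iff_right (a := 2) (by simp) (by simp), ← hdouble, ← hdouble]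
  refine Finset.sum_le_sum fun e _ => ?_
  set A : κ → ℝ := fun g => lam * ∑ k ∈ Finset.univ.erase i, ((e k : ℤ) : ℝ) * t g k with hA
  set x : κ → ℝ := fun g => lam * t g i with hx
  have e1 : ∀ g, lam * signedSum e (t g) = A g + ((e i : ℤ) : ℝ) * x g := fun g => by
    rw [signedSum_eq_add e _ i, hA, hx]; ring
  have e2 : ∀ g, lam * signedSum (flip e) (t g) = A g - ((e i : ℤ) : ℝ) * x g := fun g => by
    rw [signedSum_eq_add _ _ i, hflip_i, hA, hx]
    have : ∑ k ∈ Finset.univ.erase i, ((flip e k : ℤ) : ℝ) * t g k =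
        ∑ k ∈ Finset.univ.erase i, ((e k : ℤ) : ℝ) * t g k :=
      Finset.sum_congr rfl fun k hk => by rw [hflip_ne e k (Finset.ne_of_mem_erase hk)]
    rw [this]; push_cast; ring
  have hsum : ∀ (e : ι → ℤˣ) g, ∑ k ∈ Finset.univ.erase i, ((e k : ℤ) : ℝ) * t' g k =
      ∑ k ∈ Finset.univ.erase i, ((e k : ℤ) : ℝ) * t g k := fun e g =>
    Finset.sum_congr rfl fun k hk => by rw [hne g k (Finset.ne_of_mem_erase hk)]
  have hmax : ∀ g, lam * max (t g i) 0 = max (x g) 0 := fun g => by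
    rw [hx, mul_max_of_nonneg _ _ hlam, mul_zero]
  have e3 : ∀ g, lam * signedSum e (t' g) = A g + ((e i : ℤ) : ℝ) * max (x g) 0 := fun g => by
    rw [signedSum_eq_add e _ i, hsum, hi, ← hmax, hA]; ring
  have e4 : ∀ g, lam * signedSum (flip e) (t' g) = A g - ((e i : ℤ) : ℝ) * max (x g) 0 :=
    fun g => by
      rw [signedSum_eq_add _ _ i, hsum, hflip_i, hi, ← hmax, hA]
      have : ∑ k ∈ Finset.univ.erase i, ((flip e k : ℤ) : ℝ) * t g k =
          ∑ k ∈ Finset.univ.erase i, ((e k : ℤ) : ℝ) * t g k :=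
        Finset.sum_congr rfl fun k hk => by rw [hflip_ne e k (Finset.ne_of_mem_erase hk)]
      rw [this]; push_cast; ring
  simp only [e1, e2, e3, e4]
  rcases Int.units_eq_one_or (e i) with h | h <;> rw [h]
  · simpa using iSup_exp_relu_add_le A x
  · have := iSup_exp_relu_add_le A x
    rw [add_comm, add_comm (⨆ g, ENNReal.ofReal (Real.exp (A g + x g)))] at this
    simpa [← sub_eq_add_neg] using this

/-- The contraction principle for the positive part. -/
theorem rademacherExp_relu_le {lam : ℝ} (hlam : 0 ≤ lam) (G : Set (E → ℝ)) (u : ι → E) :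
    rademacherExp lam {f | ∃ g ∈ G, f = fun x => max (g x) 0} u ≤ rademacherExp lam G u := by
  -- Hybrids: the positive part is applied only at the coordinates in `S`, and `S` grows by one
  -- coordinate at a time.
  let t : Finset ι → G → ι → ℝ := fun S g i =>
    if i ∈ S then max ((g : E → ℝ) (u i)) 0 else (g : E → ℝ) (u i)
  have key : ∀ S : Finset ι,
      ∑ e : ι → ℤˣ, ⨆ g, ENNReal.ofReal (Real.exp (lam * signedSum e (t S g))) ≤
        rademacherExp lam G u := by
    intro S
    induction S using Finset.induction_on with
    | empty => simp [t, rademacherExp]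
    | insert i S hi ih =>
      refine (sum_comp_relu_coordinate_le hlam (t S) (t (insert i S)) i ?_ ?_).trans ih
      · intro g; simp [t, hi]
      · intro g k hk; simp [t, hk]
  refine le_trans ?_ (key Finset.univ)
  refine Finset.sum_le_sum fun e _ => iSup_le ?_
  rintro ⟨_, g, hg, rfl⟩
  refine le_trans (le_of_eq ?_)
    (le_iSup (fun g : G => ENNReal.ofReal (Real.exp (lam * signedSum e (t Finset.univ g)))) ⟨g, hg⟩)
  simp [t]

/-- A linear form on the `ℓ¹` ball is at most the largest absolute value of its coefficients, so the
number `k` of nodes disappears. The absolute value is paid for by adding the terms of `e` and `-e`,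
whence the factor 2. Nonemptiness of `F` covers `k = 0`. -/
theorem rademacherExp_lOneComb_le {k : ℕ} {F : Set (E → ℝ)} (hF : F.Nonempty) (lam : ℝ)
    (u : ι → E) : rademacherExp lam (lOneComb k F) u ≤ 2 * rademacherExp lam F u := by
  let G : (ι → ℤˣ) → ℝ≥0∞ := fun e =>
    ⨆ f : F, ENNReal.ofReal (Real.exp (lam * signedSum e fun i => (f : E → ℝ) (u i)))
  have hG : 2 * rademacherExp lam F u = ∑ e, (G e + G (-e)) := by
    have hneg : ∑ e, G (-e) = ∑ e, G e := Equiv.sum_comp (Equiv.neg (ι → ℤˣ)) G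
    rw [Finset.sum_add_distrib, hneg, two_mul]
    rfl
  rw [hG]
  refine Finset.sum_le_sum fun e _ => iSup_le ?_
  rintro ⟨_, w, g, hw, hg, rfl⟩
  have habs : ∀ f ∈ F, ENNReal.ofReal (Real.exp |lam * signedSum e fun i => f (u i)|) ≤
      G e + G (-e) := by
    intro f hf
    rcases abs_choice (lam * signedSum e fun i => f (u i)) with h | h <;> rw [h]
    · exact le_add_right (le_iSup (fun f : F => ENNReal.ofReal
        (Real.exp (lam * signedSum e fun i => (f : E → ℝ) (u i)))) ⟨f, hf⟩)
    · refine le_add_left (le_trans (le_of_eq ?_) (le_iSup (fun f : F => ENNReal.ofReal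
        (Real.exp (lam * signedSum (-e) fun i => (f : E → ℝ) (u i)))) ⟨f, hf⟩))
      rw [signedSum_neg, mul_neg]
  set v : Fin k → ℝ := fun j => lam * signedSum e fun i => g j (u i) with hv
  have hsum : lam * signedSum e (fun i => ∑ j, w j * g j (u i)) = ∑ j, w j * v j := by
    simp only [hv, signedSum, Finset.mul_sum]
    rw [Finset.sum_comm]
    exact Finset.sum_congr rfl fun j _ => Finset.sum_congr rfl fun i _ => by ring
  simp only [hsum]
  have hbound : ∃ f ∈ F, ∑ j, w j * v j ≤ |lam * signedSum e fun i => f (u i)| := by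
    rcases Nat.eq_zero_or_pos k with rfl | hk
    · obtain ⟨f, hf⟩ := hF
      exact ⟨f, hf, by rw [Finset.univ_eq_empty, Finset.sum_empty]; exact abs_nonneg _⟩
    · have : Nonempty (Fin k) := ⟨⟨0, hk⟩⟩
      obtain ⟨j, hj⟩ := Finite.exists_max fun j => |v j|
      refine ⟨g j, hg j, ?_⟩
      calc ∑ i, w i * v i ≤ ∑ i, |w i| * |v j| := by
            refine Finset.sum_le_sum fun i _ => (le_abs_self _).trans ?_
            rw [abs_mul]; exact mul_le_mul_of_nonneg_left (hj i) (abs_nonneg _)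
        _ = (∑ i, |w i|) * |v j| := (Finset.sum_mul ..).symm
        _ ≤ |v j| := mul_le_of_le_one_left (abs_nonneg _) hw
  obtain ⟨f, hf, hle⟩ := hbound
  exact (ENNReal.ofReal_le_ofReal (Real.exp_le_exp.2 hle)).trans (habs f hf)

theorem rademacherExp_hiddenLayer_le {E : Type*} [NormedAddCommGroup E] [InnerProductSpace ℝ E]
    {B : ℝ} (hB : 0 ≤ B) {d : ℕ → ℕ} (hd : ∀ j, 0 < d j) {lam : ℝ} (hlam : 0 ≤ lam) (l : ℕ)
    (u : ι → E) :
    rademacherExp lam (hiddenLayer E B d l) u ≤ 2 ^ l * rademacherExp lam (firstLayer E B) u := by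
  induction l with
  | zero => simp [hiddenLayer]
  | succ l ih =>
    have hne := (firstLayer_nonempty (E := E) hB).mono (firstLayer_subset_hiddenLayer hd l)
    calc rademacherExp lam (hiddenLayer E B d (l + 1)) u
        ≤ rademacherExp lam (lOneComb (d (l + 1)) (hiddenLayer E B d l)) u :=
          rademacherExp_relu_le hlam _ u
      _ ≤ 2 * (2 ^ l * rademacherExp lam (firstLayer E B) u) :=
          (rademacherExp_lOneComb_le hne lam u).trans (by gcongr)
      _ = _ := by rw [pow_succ]; ring

theorem rademacherExp_discriminator_le {E : Type*} [NormedAddCommGroup E] [InnerProductSpace ℝ E]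
    {B : ℝ} (hB : 0 ≤ B) {d : ℕ → ℕ} (hd : ∀ j, 0 < d j) {lam : ℝ} (hlam : 0 ≤ lam) {L : ℕ}
    (u : ι → E) :
    rademacherExp lam (discriminator E B d L) u ≤
      2 ^ L * rademacherExp lam (firstLayer E B) u := by
  match L with
  | 0 => simp [discriminator, rademacherExp]
  | 1 =>
    simp only [discriminator, pow_one, two_mul]
    exact le_add_right le_rfl
  | l + 2 =>
    have hne := (firstLayer_nonempty (E := E) hB).mono (firstLayer_subset_hiddenLayer hd l)
    calc rademacherExp lam (discriminator E B d (l + 2)) u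
        ≤ 2 * (2 ^ l * rademacherExp lam (firstLayer E B) u) :=
          (rademacherExp_lOneComb_le hne lam u).trans
            (by gcongr; exact rademacherExp_hiddenLayer_le hB hd hlam l u)
      _ = 2 ^ (l + 1) * rademacherExp lam (firstLayer E B) u := by rw [pow_succ]; ring
      _ ≤ _ := by gcongr <;> norm_num

end Rademacher

/-! ### Chaining for exponential Rademacher averages -/

/-- `Δ` is measurable and the mean of `cosh (s Δ)` is at most `exp (s² δ² / 2)` for every `s`. -/
def HasCoshBound {E : Type*} [MeasurableSpace E] (Q : Measure E) (Δ : E → ℝ) (δ : ℝ) : Prop :=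
  Measurable Δ ∧ ∀ s : ℝ, ∫⁻ x, ENNReal.ofReal (Real.cosh (s * Δ x)) ∂Q ≤
    ENNReal.ofReal (Real.exp (s ^ 2 * δ ^ 2 / 2))

theorem lintegral_pi_prod {ι : Type*} [Fintype ι] {E : Type*} [MeasurableSpace E] (Q : Measure E)
    [IsProbabilityMeasure Q] {g : E → ℝ≥0∞} (hg : Measurable g) :
    ∫⁻ u, ∏ i, g (u i) ∂(Measure.pi fun _ : ι => Q) = (∫⁻ x, g x ∂Q) ^ Fintype.card ι := by
  have hind : iIndepFun (fun (i : ι) (u : ι → E) => g (u i)) (Measure.pi fun _ : ι => Q) :=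
    iIndepFun_pi fun _ => hg.aemeasurable
  rw [lintegral_prod_eq_prod_lintegral_of_indepFun _ _ hind fun i => hg.comp (measurable_pi_apply i)]
  have : ∀ i : ι, ∫⁻ u, g (u i) ∂(Measure.pi fun _ : ι => Q) = ∫⁻ x, g x ∂Q := fun i =>
    (measurePreserving_eval (fun _ : ι => Q) i).lintegral_comp hg
  simp [this, Finset.prod_const]

namespace HasCoshBound

variable {E : Type*} [MeasurableSpace E] {Q : Measure E} {Δ Δ₁ Δ₂ : E → ℝ} {δ δ' : ℝ}

theorem mono (h : HasCoshBound Q Δ δ) (hδ : 0 ≤ δ) (hle : δ ≤ δ') : HasCoshBound Q Δ δ' :=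
  ⟨h.1, fun s => (h.2 s).trans (ENNReal.ofReal_le_ofReal (Real.exp_le_exp.2 (by gcongr)))⟩

theorem of_abs_le (h : HasCoshBound Q Δ₁ δ) (hm : Measurable Δ) (hle : ∀ x, |Δ x| ≤ |Δ₁ x|) :
    HasCoshBound Q Δ δ :=
  ⟨hm, fun s => (lintegral_mono fun x => ENNReal.ofReal_le_ofReal
    (Real.cosh_le_cosh.2 (by rw [abs_mul, abs_mul]; exact mul_le_mul_of_nonneg_left (hle x) (abs_nonneg s)))).trans (h.2 s)⟩

/-- Convexity of `cosh`: `cosh (x + y)` is at most the mean of `cosh (2x)` and `cosh (2y)`. No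
independence is needed, and the scale doubles. -/
theorem of_abs_le_add (h₁ : HasCoshBound Q Δ₁ δ) (h₂ : HasCoshBound Q Δ₂ δ) (hm : Measurable Δ)
    (hle : ∀ x, |Δ x| ≤ |Δ₁ x| + |Δ₂ x|) : HasCoshBound Q Δ (2 * δ) := by
  refine ⟨hm, fun s => ?_⟩
  have hcosh : ∀ x y : ℝ, Real.cosh (x + y) ≤ 2⁻¹ * Real.cosh (2 * x) + 2⁻¹ * Real.cosh (2 * y) := by
    intro x y
    have h1 := Real.cosh_add (x + y) (x - y)
    have h2 := Real.cosh_sub (x + y) (x - y)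
    rw [show x + y + (x - y) = 2 * x by ring] at h1
    rw [show x + y - (x - y) = 2 * y by ring] at h2
    nlinarith [Real.one_le_cosh (x - y), Real.cosh_pos (x + y)]
  calc ∫⁻ x, ENNReal.ofReal (Real.cosh (s * Δ x)) ∂Q
      ≤ ∫⁻ x, (2⁻¹ * ENNReal.ofReal (Real.cosh (2 * s * Δ₁ x)) +
          2⁻¹ * ENNReal.ofReal (Real.cosh (2 * s * Δ₂ x))) ∂Q := by
        refine lintegral_mono fun x => ?_
        have h2 : (2⁻¹ : ℝ≥0∞) = ENNReal.ofReal 2⁻¹ := by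
          rw [ENNReal.ofReal_inv_of_pos (by norm_num)]; simp
        have hp1 := (Real.cosh_pos (2 * s * Δ₁ x)).le
        have hp2 := (Real.cosh_pos (2 * s * Δ₂ x)).le
        rw [h2, ← ENNReal.ofReal_mul (by norm_num), ← ENNReal.ofReal_mul (by norm_num),
          ← ENNReal.ofReal_add (by positivity) (by positivity)]
        refine ENNReal.ofReal_le_ofReal ?_
        have h1 : Real.cosh (s * Δ x) ≤ Real.cosh (|s * Δ₁ x| + |s * Δ₂ x|) := by
          rw [Real.cosh_le_cosh, abs_mul, abs_mul, abs_mul, ← mul_add, abs_mul, abs_abs]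
          exact mul_le_mul_of_nonneg_left ((hle x).trans (le_abs_self _)) (abs_nonneg s)
        refine h1.trans ((hcosh _ _).trans (le_of_eq ?_))
        rw [← Real.cosh_abs (2 * s * Δ₁ x), ← Real.cosh_abs (2 * s * Δ₂ x), mul_assoc 2 s,
          mul_assoc 2 s, abs_mul 2, abs_mul 2, abs_of_pos (two_pos : (0 : ℝ) < 2)]
    _ = 2⁻¹ * ∫⁻ x, ENNReal.ofReal (Real.cosh (2 * s * Δ₁ x)) ∂Q +
          2⁻¹ * ∫⁻ x, ENNReal.ofReal (Real.cosh (2 * s * Δ₂ x)) ∂Q := by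
        have m : ∀ {D : E → ℝ}, Measurable D →
            Measurable fun x => ENNReal.ofReal (Real.cosh (2 * s * D x)) := fun hD =>
          (Real.continuous_cosh.measurable.comp (hD.const_mul _)).ennreal_ofReal
        rw [lintegral_add_left ((m h₁.1).const_mul _), lintegral_const_mul _ (m h₁.1),
          lintegral_const_mul _ (m h₂.1)]
    _ ≤ 2⁻¹ * ENNReal.ofReal (Real.exp ((2 * s) ^ 2 * δ ^ 2 / 2)) +
          2⁻¹ * ENNReal.ofReal (Real.exp ((2 * s) ^ 2 * δ ^ 2 / 2)) := by
        gcongr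
        exacts [h₁.2 _, h₂.2 _]
    _ = ENNReal.ofReal (Real.exp (s ^ 2 * (2 * δ) ^ 2 / 2)) := by
        rw [← add_mul, ENNReal.inv_two_add_inv_two, one_mul]
        congr 3; ring

theorem const [IsProbabilityMeasure Q] (c : ℝ) : HasCoshBound Q (fun _ => c) c := by
  refine ⟨measurable_const, fun s => ?_⟩
  rw [lintegral_const, measure_univ, mul_one]
  refine ENNReal.ofReal_le_ofReal ((Real.cosh_le_exp_half_sq _).trans (le_of_eq ?_))
  rw [mul_pow]

theorem inner {E : Type*} [NormedAddCommGroup E] [InnerProductSpace ℝ E] [MeasurableSpace E]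
    [BorelSpace E] {Q : Measure E} {v : ℝ}
    (hQ : ∀ w : E, ∫⁻ x, ENNReal.ofReal (Real.exp (inner ℝ w x)) ∂Q ≤
      ENNReal.ofReal (Real.exp (v ^ 2 * ‖w‖ ^ 2 / 2))) (a : E) :
    HasCoshBound Q (fun x => Inner.inner ℝ a x) (v * ‖a‖) := by
  have hc : Continuous fun x => Inner.inner ℝ a x := by fun_prop
  refine ⟨hc.measurable, fun s => ?_⟩
  have hm : ∀ w : E, Measurable fun x => ENNReal.ofReal (Real.exp (Inner.inner ℝ w x)) := fun w =>
    (Real.continuous_exp.comp (by fun_prop : Continuous fun x => Inner.inner ℝ w x)).measurable.ennreal_ofReal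
  calc ∫⁻ x, ENNReal.ofReal (Real.cosh (s * Inner.inner ℝ a x)) ∂Q
      = ∫⁻ x, (2⁻¹ * ENNReal.ofReal (Real.exp (Inner.inner ℝ (s • a) x)) +
          2⁻¹ * ENNReal.ofReal (Real.exp (Inner.inner ℝ (-(s • a)) x))) ∂Q := by
        refine lintegral_congr fun x => ?_
        have h2 : (2⁻¹ : ℝ≥0∞) = ENNReal.ofReal 2⁻¹ := by
          rw [ENNReal.ofReal_inv_of_pos (by norm_num)]; simp
        rw [h2, ← ENNReal.ofReal_mul (by norm_num), ← ENNReal.ofReal_mul (by norm_num),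
          ← ENNReal.ofReal_add (by positivity) (by positivity), Real.cosh_eq, inner_neg_left,
          real_inner_smul_left]
        congr 1; ring
    _ ≤ 2⁻¹ * ENNReal.ofReal (Real.exp (v ^ 2 * ‖s • a‖ ^ 2 / 2)) +
          2⁻¹ * ENNReal.ofReal (Real.exp (v ^ 2 * ‖-(s • a)‖ ^ 2 / 2)) := by
        rw [lintegral_add_left ((hm _).const_mul _), lintegral_const_mul _ (hm _),
          lintegral_const_mul _ (hm _)]
        gcongr
        exacts [hQ _, hQ _]
    _ = ENNReal.ofReal (Real.exp (s ^ 2 * (v * ‖a‖) ^ 2 / 2)) := by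
        rw [norm_neg, ← add_mul, ENNReal.inv_two_add_inv_two, one_mul, norm_smul, mul_pow,
          Real.norm_eq_abs, sq_abs]
        congr 3; ring

/-- Summing over signs factorizes the exponential into a product of `2 cosh`, which is why `cosh`
moments are the right hypothesis: they are insensitive to signs and monotone in `|Δ|`. -/
theorem lintegral_sum_exp_le {ι : Type*} [Fintype ι] [DecidableEq ι] [IsProbabilityMeasure Q]
    (h : HasCoshBound Q Δ δ) (s : ℝ) :
    ∫⁻ u, ∑ e : ι → ℤˣ, ENNReal.ofReal (Real.exp (s * signedSum e fun i => Δ (u i)))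
        ∂(Measure.pi fun _ : ι => Q) ≤
      2 ^ Fintype.card ι * ENNReal.ofReal (Real.exp (Fintype.card ι * (s ^ 2 * δ ^ 2 / 2))) := by
  have hpt : ∀ u : ι → E,
      ∑ e : ι → ℤˣ, ENNReal.ofReal (Real.exp (s * signedSum e fun i => Δ (u i))) =
        ∏ i, (2 * ENNReal.ofReal (Real.cosh (s * Δ (u i)))) := by
    intro u
    have h1 : ∀ i, 2 * ENNReal.ofReal (Real.cosh (s * Δ (u i))) =
        ∑ ε : ℤˣ, ENNReal.ofReal (Real.exp (s * (((ε : ℤ) : ℝ) * Δ (u i)))) := by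
      intro i
      rw [show (2 : ℝ≥0∞) = ENNReal.ofReal 2 by simp, ← ENNReal.ofReal_mul (by norm_num),
        ← ENNReal.ofReal_sum_of_nonneg fun _ _ => (Real.exp_pos _).le]
      congr 1
      rw [show (Finset.univ : Finset ℤˣ) = {1, -1} by decide,
        Finset.sum_pair (by decide), Real.cosh_eq]
      simp; ring
    simp_rw [h1]
    rw [Finset.prod_univ_sum, Fintype.piFinset_univ]
    refine Finset.sum_congr rfl fun e _ => ?_
    rw [← ENNReal.ofReal_prod_of_nonneg fun _ _ => (Real.exp_pos _).le, ← Real.exp_sum,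
      ← Finset.mul_sum]
    rfl
  simp_rw [hpt]
  have hm : Measurable fun x => ENNReal.ofReal (Real.cosh (s * Δ x)) :=
    (Real.continuous_cosh.measurable.comp (h.1.const_mul _)).ennreal_ofReal
  rw [lintegral_pi_prod Q (g := fun x => 2 * ENNReal.ofReal (Real.cosh (s * Δ x)))
    (hm.const_mul _), lintegral_const_mul _ hm, mul_pow]
  gcongr
  rw [Real.exp_nat_mul, ENNReal.ofReal_pow (Real.exp_pos _).le]
  gcongr
  exact h.2 s

end HasCoshBound

theorem sum_geometric_weights (J : ℕ) :
    ((1 : ℝ) / 2 ^ J + ∑ j ∈ Finset.range J, 1 / 2 / 2 ^ j = 1) ∧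
      ∑ j ∈ Finset.range J, (1 : ℝ) / 2 / 2 ^ j * (j + 1) = 2 - (J + 2) / 2 ^ J := by
  induction J with
  | zero => simp
  | succ J ih =>
    have h : (1 : ℝ) / 2 ^ (J + 1) + 1 / 2 / 2 ^ J = 1 / 2 ^ J := by
      rw [pow_succ]; field_simp; norm_num
    rw [Finset.sum_range_succ, Finset.sum_range_succ, ih.2]
    refine ⟨by rw [add_left_comm, h, add_comm, ih.1], ?_⟩
    rw [pow_succ]; push_cast; field_simp; ring

/-- Jensen for `exp` with weight `2 ^ -(j + 1)` on level `j` and the remaining `2 ^ -J` on `0`.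
Subtracting `(j + 1) log M` from level `j` produces the discount that will pay for the number of
links there; as the weighted sum of `j + 1` is at most 2, restoring it costs only `M ^ 2`. -/
theorem exp_chain_le {M lam : ℝ} (hM : 1 ≤ M) (v : ℕ → ℝ) (J : ℕ) :
    Real.exp (lam * ∑ j ∈ Finset.range J, v j) ≤
      M ^ 2 * (1 + ∑ j ∈ Finset.range J,
        1 / 2 / 2 ^ j * (M⁻¹) ^ (j + 1) * Real.exp (lam * 2 ^ (j + 1) * v j)) := by
  have hM0 : 0 < M := by linarith
  set z : ℕ → ℝ := fun j => lam * 2 ^ (j + 1) * v j - (j + 1) * Real.log M with hz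
  obtain ⟨hw1, hw2⟩ := sum_geometric_weights J
  have hlog : 0 ≤ Real.log M := Real.log_nonneg hM
  have hsum : lam * ∑ j ∈ Finset.range J, v j =
      (2 - (J + 2) / 2 ^ J) * Real.log M + ∑ j ∈ Finset.range J, (1 / 2 / 2 ^ j) * z j := by
    rw [← hw2, Finset.sum_mul, ← Finset.sum_add_distrib, Finset.mul_sum]
    refine Finset.sum_congr rfl fun j _ => ?_
    simp only [hz]; rw [pow_succ]; field_simp; ring
  have hjensen := convexOn_exp.map_add_sum_le (t := Finset.range J)
    (w := fun j => (1 : ℝ) / 2 / 2 ^ j) (v := 1 / 2 ^ J) (q := 0) (p := z)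
    (fun _ _ => by positivity) hw1 (fun _ _ => Set.mem_univ _) (by positivity) (Set.mem_univ _)
  simp only [smul_eq_mul, mul_zero, zero_add, Real.exp_zero, mul_one] at hjensen
  have hexpz : ∀ j, Real.exp (z j) = (M⁻¹) ^ (j + 1) * Real.exp (lam * 2 ^ (j + 1) * v j) := by
    intro j
    simp only [hz]
    rw [sub_eq_add_neg, add_comm, Real.exp_add, ← mul_neg, ← Real.log_inv]
    congr 1
    have := Real.exp_nat_mul (Real.log M⁻¹) (j + 1)
    rw [Real.exp_log (by positivity)] at this
    rw [← this]; push_cast; rfl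
  rw [hsum, Real.exp_add]
  refine mul_le_mul ?_ ?_ (Real.exp_pos _).le (by positivity)
  · rw [← Real.exp_log (pow_pos hM0 2), Real.log_pow]
    refine Real.exp_le_exp.2 (mul_le_mul_of_nonneg_right ?_ hlog)
    have : (0 : ℝ) ≤ (J + 2) / 2 ^ J := by positivity
    push_cast; linarith
  · refine hjensen.trans (add_le_add ?_ (le_of_eq ?_))
    · exact div_le_one_of_le₀ (one_le_pow₀ (by norm_num)) (by positivity)
    · refine Finset.sum_congr rfl fun j _ => ?_
      rw [hexpz, ← mul_assoc]

/-- Level `j` has at most `M ^ (j + 1)` links, cancelled by the discount in `exp_chain_le`. Their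
scale `K / 2 ^ j` is cancelled by the magnification `2 ^ (j + 1)` of `lam`. All levels therefore
give the same exponential, with summable weights. -/
theorem lintegral_rademacherExp_le_of_chain {ι : Type*} [Fintype ι] [DecidableEq ι] {E : Type*}
    [MeasurableSpace E] (Q : Measure E) [IsProbabilityMeasure Q] {F : Set (E → ℝ)} {K M : ℝ}
    (hM : 1 ≤ M) (Λ : ℕ → Finset (E → ℝ)) (hcard : ∀ j, ((Λ j).card : ℝ) ≤ M ^ (j + 1))
    (hΛ : ∀ j, ∀ Δ ∈ Λ j, HasCoshBound Q Δ (K / 2 ^ j))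
    (hF : ∀ f ∈ F, ∃ D : ℕ → E → ℝ, (∀ j, D j ∈ Λ j) ∧
      ∀ x, Filter.Tendsto (fun J => ∑ j ∈ Finset.range J, D j x) Filter.atTop (nhds (f x)))
    (lam : ℝ) :
    ∫⁻ u, rademacherExp lam F u ∂(Measure.pi fun _ : ι => Q) ≤ 2 ^ Fintype.card ι *
      ENNReal.ofReal (2 * M ^ 2 * Real.exp (2 * Fintype.card ι * K ^ 2 * lam ^ 2)) := by
  have hM0 : 0 < M := by linarith
  set c : ℕ → ℝ := fun j => 1 / 2 / 2 ^ j * (M⁻¹) ^ (j + 1) with hc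
  have hc0 : ∀ j, 0 ≤ c j := fun j => by positivity
  let h : (j : ℕ) → (E → ℝ) → (ι → E) → (ι → ℤˣ) → ℝ≥0∞ := fun j Δ u e =>
    ENNReal.ofReal (Real.exp (lam * 2 ^ (j + 1) * signedSum e fun i => Δ (u i)))
  have hpt : ∀ (u : ι → E) (e : ι → ℤˣ) (f : F),
      ENNReal.ofReal (Real.exp (lam * signedSum e fun i => (f : E → ℝ) (u i))) ≤
        ENNReal.ofReal (M ^ 2) * (1 + ∑' j, ∑ Δ ∈ Λ j, ENNReal.ofReal (c j) * h j Δ u e) := by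
    intro u e f
    obtain ⟨D, hD, hlim⟩ := hF f f.2
    have hlim' : Filter.Tendsto (fun J => ENNReal.ofReal (Real.exp (lam *
        ∑ j ∈ Finset.range J, signedSum e fun i => D j (u i)))) Filter.atTop
        (nhds (ENNReal.ofReal (Real.exp (lam * signedSum e fun i => (f : E → ℝ) (u i))))) := by
      refine ENNReal.tendsto_ofReal ((Real.continuous_exp.tendsto _).comp
        (Filter.Tendsto.const_mul lam ?_))
      have : ∀ J, ∑ j ∈ Finset.range J, signedSum e (fun i => D j (u i)) =
          ∑ i, ((e i : ℤ) : ℝ) * ∑ j ∈ Finset.range J, D j (u i) := fun J => by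
        simp only [signedSum, Finset.mul_sum]
        rw [Finset.sum_comm]
      simp_rw [this]
      exact tendsto_finsetSum _ fun i _ => (hlim (u i)).const_mul _
    refine le_of_tendsto' hlim' fun J => ?_
    refine (ENNReal.ofReal_le_ofReal (exp_chain_le hM _ J)).trans ?_
    rw [ENNReal.ofReal_mul (by positivity), ENNReal.ofReal_add zero_le_one
      (Finset.sum_nonneg fun j _ => by positivity), ENNReal.ofReal_one,
      ENNReal.ofReal_sum_of_nonneg fun j _ => by positivity]
    gcongr
    refine le_trans (Finset.sum_le_sum fun j _ => ?_)
      (ENNReal.sum_le_tsum (Finset.range J))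
    rw [ENNReal.ofReal_mul (hc0 j)]
    -- The link used by `f` is one term of the sum over all links of the level, so the bound no
    -- longer depends on `f`.
    exact Finset.single_le_sum (f := fun Δ => ENNReal.ofReal (c j) * h j Δ u e)
      (fun _ _ => zero_le) (hD j)
  have hmeas : ∀ j, ∀ Δ ∈ Λ j, Measurable fun u => ∑ e, h j Δ u e := by
    intro j Δ hΔ
    refine Finset.measurable_sum _ fun e _ => ?_
    have := (hΛ j Δ hΔ).1
    refine (Real.continuous_exp.measurable.comp (Measurable.const_mul ?_ _)).ennreal_ofReal
    exact Finset.measurable_sum _ fun i _ => (this.comp (measurable_pi_apply i)).const_mul _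
  have hsum : ∀ u : ι → E, rademacherExp lam F u ≤ ENNReal.ofReal (M ^ 2) *
      (2 ^ Fintype.card ι + ∑' j, ∑ Δ ∈ Λ j, ENNReal.ofReal (c j) * ∑ e, h j Δ u e) := by
    intro u
    refine (Finset.sum_le_sum fun e _ => iSup_le (hpt u e)).trans (le_of_eq ?_)
    rw [← Finset.mul_sum, Finset.sum_add_distrib, ← Summable.tsum_finsetSum
      fun _ _ => ENNReal.summable]
    congr 2
    · simp [Fintype.card_units_int]
    · refine tsum_congr fun j => ?_
      rw [Finset.sum_comm]
      simp_rw [Finset.mul_sum]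
  set T : ℝ≥0∞ := 2 ^ Fintype.card ι *
    ENNReal.ofReal (Real.exp (2 * Fintype.card ι * K ^ 2 * lam ^ 2)) with hT
  have hterm : ∀ j, ∑ Δ ∈ Λ j, ENNReal.ofReal (c j) *
      ∫⁻ u, ∑ e, h j Δ u e ∂(Measure.pi fun _ : ι => Q) ≤ ENNReal.ofReal (1 / 2 / 2 ^ j) * T := by
    intro j
    have h1 : ∀ Δ ∈ Λ j, ENNReal.ofReal (c j) *
        ∫⁻ u, ∑ e, h j Δ u e ∂(Measure.pi fun _ : ι => Q) ≤ ENNReal.ofReal (c j) * T := by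
      intro Δ hΔ
      gcongr
      refine ((hΛ j Δ hΔ).lintegral_sum_exp_le (lam * 2 ^ (j + 1))).trans (le_of_eq ?_)
      rw [hT]
      congr 3
      rw [pow_succ]; field_simp; ring
    refine (Finset.sum_le_sum h1).trans ?_
    rw [Finset.sum_const, nsmul_eq_mul, ← mul_assoc]
    gcongr
    rw [← ENNReal.ofReal_natCast, ← ENNReal.ofReal_mul (by positivity)]
    refine ENNReal.ofReal_le_ofReal ?_
    calc ((Λ j).card : ℝ) * c j ≤ M ^ (j + 1) * c j := by exact mul_le_mul_of_nonneg_right (hcard j) (hc0 j)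
      _ = _ := by
        rw [hc]
        have : M ^ (j + 1) * M⁻¹ ^ (j + 1) = 1 := by rw [← mul_pow, mul_inv_cancel₀ hM0.ne', one_pow]
        linear_combination (1 / 2 / 2 ^ j) * this
  have hgeom : ∑' j : ℕ, ENNReal.ofReal (1 / 2 / 2 ^ j) = 1 := by
    have := hasSum_geometric_two' (1 : ℝ)
    rw [← ENNReal.ofReal_tsum_of_nonneg (fun _ => by positivity) this.summable, this.tsum_eq,
      ENNReal.ofReal_one]
  have hT1 : (2 : ℝ≥0∞) ^ Fintype.card ι ≤ T := by
    rw [hT]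
    refine le_mul_of_one_le_right' ?_
    rw [← ENNReal.ofReal_one]
    exact ENNReal.ofReal_le_ofReal (Real.one_le_exp (by positivity))
  have hms : Measurable fun u : ι → E =>
      ∑' j, ∑ Δ ∈ Λ j, ENNReal.ofReal (c j) * ∑ e, h j Δ u e :=
    Measurable.tsum fun j => Finset.measurable_sum _ fun Δ hΔ =>
      (hmeas j Δ hΔ).const_mul _
  calc ∫⁻ u, rademacherExp lam F u ∂(Measure.pi fun _ : ι => Q)
      ≤ ∫⁻ u, ENNReal.ofReal (M ^ 2) * (2 ^ Fintype.card ι +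
          ∑' j, ∑ Δ ∈ Λ j, ENNReal.ofReal (c j) * ∑ e, h j Δ u e)
          ∂(Measure.pi fun _ : ι => Q) := lintegral_mono hsum
    _ = ENNReal.ofReal (M ^ 2) * (2 ^ Fintype.card ι +
          ∑' j, ∑ Δ ∈ Λ j, ENNReal.ofReal (c j) *
            ∫⁻ u, ∑ e, h j Δ u e ∂(Measure.pi fun _ : ι => Q)) := by
        rw [lintegral_const_mul _ (hms.const_add _), lintegral_add_left measurable_const,
          lintegral_const, measure_univ, mul_one, lintegral_tsum fun j =>
            (Finset.measurable_sum _ fun Δ hΔ => (hmeas j Δ hΔ).const_mul _).aemeasurable]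
        congr 3
        funext j
        rw [lintegral_finsetSum' _ fun Δ hΔ => ((hmeas j Δ hΔ).const_mul _).aemeasurable]
        exact Finset.sum_congr rfl fun Δ hΔ => lintegral_const_mul _ (hmeas j Δ hΔ)
    _ ≤ ENNReal.ofReal (M ^ 2) * (T + T) := by
        gcongr
        refine (ENNReal.tsum_le_tsum hterm).trans (le_of_eq ?_)
        rw [ENNReal.tsum_mul_right, hgeom, one_mul]
    _ = _ := by
        rw [← two_mul, hT, show (2 : ℝ) * M ^ 2 = M ^ 2 * 2 by ring,
          ENNReal.ofReal_mul (by positivity), ENNReal.ofReal_mul (by positivity)]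
        simp only [ENNReal.ofReal_ofNat]
        ring

theorem lintegral_rademacherExp_firstLayer_le {ι : Type*} [Fintype ι] [DecidableEq ι] {E : Type*}
    [NormedAddCommGroup E] [InnerProductSpace ℝ E] [FiniteDimensional ℝ E] [MeasurableSpace E]
    [BorelSpace E] (Q : Measure E) [IsProbabilityMeasure Q] {B v : ℝ} (hB : 0 ≤ B) (hv : 0 ≤ v)
    (hQ : ∀ w : E, ∫⁻ x, ENNReal.ofReal (Real.exp (inner ℝ w x)) ∂Q ≤
      ENNReal.ofReal (Real.exp (v ^ 2 * ‖w‖ ^ 2 / 2))) (lam : ℝ) :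
    ∫⁻ u, rademacherExp lam (firstLayer E B) u ∂(Measure.pi fun _ : ι => Q) ≤
      2 ^ Fintype.card ι * ENNReal.ofReal (2 * (144 * 25 ^ Module.finrank ℝ E) ^ 2 *
        Real.exp (2 * Fintype.card ι * (16 * (2 + 4 * v * (B + 1))) ^ 2 * lam ^ 2)) := by
  classical
  -- The net construction needs a positive radius, also when `B = 0`.
  set R := B + 1 with hR
  have hRpos : 0 < R := by linarith
  set K := 2 + 4 * v * R with hK
  have hK2 : 2 ≤ K := by rw [hK]; linarith [show 0 ≤ 4 * v * R by positivity]
  have hvR : 4 * (v * R) ≤ K := by rw [hK]; linarith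
  set D := Module.finrank ℝ E
  choose A hAcard hAnet using fun j => exists_ball_net E hRpos j
  let φ : E → ℝ → E → ℝ := fun w b x => Real.sigmoid (inner ℝ w x + b)
  have hφm : ∀ w b, Measurable (φ w b) := fun w b => by
    have : Continuous (φ w b) := by
      have := continuous_sigmoid
      simp only [φ]; fun_prop
    exact this.measurable
  let N : ℕ → Finset (E → ℝ) := fun j => Finset.image₂ φ (A j) (biasGrid j)
  have hNcard : ∀ j, (N j).card ≤ (5 ^ D) ^ j * (3 * 4 ^ j) := fun j =>
    (Finset.card_image₂_le _ _ _).trans (Nat.mul_le_mul (hAcard j) (card_biasGrid_le j))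
  -- Among all differences of consecutive net points only those of the right scale are kept. The
  -- moment condition then holds by definition, and it remains to see that the links of an actual
  -- node survive the filter.
  let Λ : ℕ → Finset (E → ℝ) := fun j => Nat.casesOn j (N 0) fun j =>
    (Finset.image₂ (fun f g => g - f) (N j) (N (j + 1))).filter
      fun Δ => HasCoshBound Q Δ (16 * K / 2 ^ (j + 1))
  refine lintegral_rademacherExp_le_of_chain Q ?_ Λ ?_ ?_ ?_ lam
  · have : (1 : ℝ) ≤ 25 ^ D := one_le_pow₀ (by norm_num)
    linarith
  · rintro (_ | j)
    · have h := hNcard 0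
      have : (1 : ℝ) ≤ 25 ^ D := one_le_pow₀ (by norm_num)
      have h' : ((N 0).card : ℝ) ≤ 3 := by exact_mod_cast (by simpa using h)
      change ((N 0).card : ℝ) ≤ (144 * 25 ^ D) ^ (0 + 1)
      rw [zero_add, pow_one]
      linarith
    · have h1 : (Λ (j + 1)).card ≤ (144 * 25 ^ D) ^ (j + 2) := by
        refine (Finset.card_filter_le _ _).trans ((Finset.card_image₂_le _ _ _).trans ?_)
        refine (Nat.mul_le_mul (hNcard j) (hNcard (j + 1))).trans ?_
        calc (5 ^ D) ^ j * (3 * 4 ^ j) * ((5 ^ D) ^ (j + 1) * (3 * 4 ^ (j + 1)))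
            ≤ (5 ^ D) ^ j * (3 * 4 ^ j) * ((5 ^ D) ^ (j + 1) * (3 * 4 ^ (j + 1))) *
              ((5 ^ D) ^ 3 * 4 ^ 3 * 9 ^ (j + 1)) :=
              Nat.le_mul_of_pos_right _ (by positivity)
          _ = (144 * 25 ^ D) ^ (j + 2) := by
              rw [show (144 : ℕ) = 4 * 4 * 9 by norm_num, show (25 : ℕ) = 5 * 5 by norm_num]
              simp only [mul_pow]
              ring
      exact_mod_cast h1
  · rintro (_ | j) Δ hΔ
    · obtain ⟨w, -, b, -, rfl⟩ := Finset.mem_image₂.1 hΔ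
      refine ((HasCoshBound.const 1).mono zero_le_one ?_).of_abs_le (hφm w b) fun x => ?_
      · rw [pow_zero]; linarith
      · rw [abs_one, abs_of_nonneg (Real.sigmoid_nonneg _)]
        exact Real.sigmoid_le_one _
    · exact (Finset.mem_filter.1 hΔ).2
  · rintro _ ⟨w, b, hw, rfl⟩
    choose a haA haw using fun j => hAnet j w (by linarith)
    choose c hcG hcb using fun j => exists_mem_biasGrid j b
    -- Net points may lie outside the ball, but not beyond twice its radius.
    have hanorm : ∀ j, ‖a j‖ ≤ 2 * R := fun j => by
      have h1 : R / 2 ^ j ≤ R := div_le_self hRpos.le (one_le_pow₀ (by norm_num))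
      have h2 := norm_sub_norm_le (a j) w
      rw [norm_sub_rev] at h2
      linarith [haw j]
    have hdiff : ∀ j x, |φ w b x - φ (a j) (c j) x| ≤
        |inner ℝ (w - a j) x| + 2 * (1 + |inner ℝ (a j) x|) / 2 ^ j := fun j x => by
      refine (abs_sub_le _ (Real.sigmoid (inner ℝ (a j) x + b)) _).trans
        (add_le_add ((abs_sigmoid_sub_le _ _).trans (le_of_eq ?_)) (hcb j _))
      rw [inner_sub_left]; congr 1; ring
    have hbound : ∀ j, HasCoshBound Q (fun x => φ w b x - φ (a j) (c j) x) (4 * K / 2 ^ j) := by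
      intro j
      have h2j : (0 : ℝ) < 2 ^ j := by positivity
      have k1 : HasCoshBound Q (fun x => inner ℝ (w - a j) x) (2 * (K / 2 ^ j)) := by
        refine (HasCoshBound.inner hQ (w - a j)).mono (by positivity) ?_
        calc v * ‖w - a j‖ ≤ v * (R / 2 ^ j) := by gcongr; exact haw j
          _ = v * R / 2 ^ j := by ring
          _ ≤ (2 * K) / 2 ^ j := div_le_div_of_nonneg_right (by linarith [mul_nonneg hv hRpos.le]) h2j.le
          _ = _ := by ring
      have k2 : HasCoshBound Q (fun _ => (2 / 2 ^ j : ℝ)) (K / 2 ^ j) :=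
        (HasCoshBound.const _).mono (by positivity) (by gcongr)
      have k3 : HasCoshBound Q (fun x => inner ℝ ((2 / 2 ^ j : ℝ) • a j) x) (K / 2 ^ j) := by
        refine (HasCoshBound.inner hQ _).mono (by positivity) ?_
        rw [norm_smul, Real.norm_of_nonneg (by positivity)]
        calc v * (2 / 2 ^ j * ‖a j‖) ≤ v * (2 / 2 ^ j * (2 * R)) := by gcongr; exact hanorm j
          _ = 4 * (v * R) / 2 ^ j := by ring
          _ ≤ K / 2 ^ j := by gcongr
      have k4 : HasCoshBound Q (fun x => 2 * (1 + |inner ℝ (a j) x|) / 2 ^ j)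
          (2 * (K / 2 ^ j)) := by
        refine k2.of_abs_le_add k3 ?_ fun x => ?_
        · have : Continuous fun x : E => 2 * (1 + |inner ℝ (a j) x|) / 2 ^ j := by fun_prop
          exact this.measurable
        · rw [real_inner_smul_left, abs_mul, abs_of_nonneg (by positivity),
            abs_of_pos (show (0 : ℝ) < 2 / 2 ^ j by positivity)]
          apply le_of_eq; ring
      have k5 := k1.of_abs_le_add k4 ((hφm w b).sub (hφm (a j) (c j))) fun x =>
        (hdiff j x).trans (add_le_add le_rfl (le_abs_self _))
      rw [show 4 * K / 2 ^ j = 2 * (2 * (K / 2 ^ j)) by ring]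
      exact k5
    let D' : ℕ → E → ℝ := fun j => Nat.casesOn j (φ (a 0) (c 0)) fun j =>
      φ (a (j + 1)) (c (j + 1)) - φ (a j) (c j)
    have hN : ∀ j, φ (a j) (c j) ∈ N j := fun j => Finset.mem_image₂_of_mem (haA j) (hcG j)
    have hsum : ∀ J x, ∑ j ∈ Finset.range (J + 1), D' j x = φ (a J) (c J) x := fun J x => by
      induction J with
      | zero => simp [D']
      | succ J ih => rw [Finset.sum_range_succ, ih]; simp [D']
    refine ⟨D', ?_, fun x => ?_⟩
    · rintro (_ | j)
      · exact hN 0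
      · refine Finset.mem_filter.2 ⟨Finset.mem_image₂_of_mem (hN j) (hN (j + 1)), ?_⟩
        have hle : 4 * K / 2 ^ (j + 1) ≤ 4 * K / 2 ^ j := by
          gcongr <;> norm_num
        have h := (hbound j).of_abs_le_add ((hbound (j + 1)).mono (by positivity) hle)
          ((hφm (a (j + 1)) (c (j + 1))).sub (hφm (a j) (c j))) fun x => by
            refine (le_of_eq ?_).trans (abs_sub _ _)
            rw [Pi.sub_apply]; congr 1; ring
        rw [show 16 * K / 2 ^ (j + 1) = 2 * (4 * K / 2 ^ j) by rw [pow_succ]; field_simp; ring]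
        exact h
    · rw [← Filter.tendsto_add_atTop_iff_nat 1]
      simp_rw [hsum]
      rw [tendsto_iff_norm_sub_tendsto_zero]
      have hz : Filter.Tendsto (fun j : ℕ => (R * ‖x‖ + 2 * (1 + 2 * R * ‖x‖)) * (1 / 2) ^ j)
          Filter.atTop (nhds 0) := by
        simpa using (tendsto_pow_atTop_nhds_zero_of_lt_one (r := (1 / 2 : ℝ)) (by norm_num)
          (by norm_num)).const_mul (R * ‖x‖ + 2 * (1 + 2 * R * ‖x‖))
      refine squeeze_zero (fun _ => norm_nonneg _) (fun j => ?_) hz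
      rw [norm_sub_rev]
      refine (hdiff j x).trans ?_
      have i1 : |inner ℝ (w - a j) x| ≤ R / 2 ^ j * ‖x‖ :=
        (abs_real_inner_le_norm _ _).trans (by gcongr; exact haw j)
      have i2 : |inner ℝ (a j) x| ≤ 2 * R * ‖x‖ :=
        (abs_real_inner_le_norm _ _).trans (by gcongr; exact hanorm j)
      calc _ ≤ R / 2 ^ j * ‖x‖ + 2 * (1 + 2 * R * ‖x‖) / 2 ^ j := by gcongr
        _ = _ := by rw [one_div, inv_pow]; ring

/-! ### Symmetrization -/

/-- The supremum is uncountable; lower semicontinuity replaces a separability argument. -/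
theorem measurable_iSup_of_continuous {κ X : Type*} [TopologicalSpace X] [MeasurableSpace X]
    [OpensMeasurableSpace X] {g : κ → X → ℝ} (hg : ∀ k, Continuous (g k)) :
    Measurable fun x => ⨆ k, ENNReal.ofReal (Real.exp (g k x)) := by
  refine LowerSemicontinuous.measurable (lowerSemicontinuous_iSup fun k => ?_)
  exact (ENNReal.continuous_ofReal.comp (Real.continuous_exp.comp (hg k))).lowerSemicontinuous

theorem continuous_signedSum_comp {ι X : Type*} [Fintype ι] [TopologicalSpace X] (lam : ℝ)
    (e : ι → ℤˣ) {g : X → ι → ℝ} (hg : ∀ i, Continuous fun x => g x i) :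
    Continuous fun x => lam * signedSum e (g x) := by
  unfold signedSum
  fun_prop

theorem exp_neg_integral_le {E : Type*} [MeasurableSpace E] (Q : Measure E)
    [IsProbabilityMeasure Q] {f : E → ℝ} (hf : Measurable f) (hf1 : ∀ x, |f x| ≤ 1) (lam : ℝ) :
    ENNReal.ofReal (Real.exp (-(lam * ∫ x, f x ∂Q))) ≤
      ∫⁻ x, ENNReal.ofReal (Real.exp (-(lam * f x))) ∂Q := by
  have hfi : Integrable f Q := .of_bound hf.aestronglyMeasurable 1 (.of_forall hf1)
  have hexp : Integrable (fun x => Real.exp (-(lam * f x))) Q := by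
    refine .of_bound (Real.continuous_exp.measurable.comp (hf.const_mul lam).neg).aestronglyMeasurable
      (Real.exp |lam|) (.of_forall fun x => ?_)
    rw [Real.norm_of_nonneg (Real.exp_pos _).le]
    refine Real.exp_le_exp.2 ((neg_le_abs _).trans ?_)
    rw [abs_mul]
    exact mul_le_of_le_one_right (abs_nonneg _) (hf1 x)
  rw [← ofReal_integral_eq_lintegral_ofReal hexp (.of_forall fun x => (Real.exp_pos _).le)]
  refine ENNReal.ofReal_le_ofReal ?_
  have := convexOn_exp.map_integral_le (μ := Q) (f := fun x => -(lam * f x))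
    Real.continuous_exp.continuousOn isClosed_univ (.of_forall fun _ => Set.mem_univ _)
    (hfi.const_mul lam).neg hexp
  rwa [integral_neg, integral_const_mul] at this

/-- Jensen replaces the mean by an independent ghost sample, random swaps of the two samples
introduce the signs, and `exp (a + b) ≤ (exp (2a) + exp (2b)) / 2` separates the samples, at the
price of doubling `lam`. -/
theorem lintegral_iSup_exp_le_rademacherExp {ι : Type*} [Fintype ι] [DecidableEq ι] {E : Type*}
    [TopologicalSpace E] [SecondCountableTopology E] [MeasurableSpace E] [BorelSpace E]
    (Q : Measure E) [IsProbabilityMeasure Q] {F : Set (E → ℝ)}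
    (hF : ∀ f ∈ F, Continuous f ∧ ∀ x, |f x| ≤ 1) (lam : ℝ) :
    2 ^ Fintype.card ι * ∫⁻ u, ⨆ f : F, ENNReal.ofReal (Real.exp
        (lam * ∑ i, ((f : E → ℝ) (u i) - ∫ x, (f : E → ℝ) x ∂Q))) ∂(Measure.pi fun _ : ι => Q) ≤
      ∫⁻ u, rademacherExp (2 * lam) F u ∂(Measure.pi fun _ : ι => Q) := by
  let S : (ι → ℤˣ) → (ι → E × E) → ℝ≥0∞ := fun e z => ⨆ f : F, ENNReal.ofReal (Real.exp
    (lam * signedSum e fun i => (f : E → ℝ) (z i).1 - (f : E → ℝ) (z i).2))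
  set μ : Measure (ι → E) := Measure.pi fun _ : ι => Q
  set ν : Measure (ι → E × E) := Measure.pi fun _ : ι => Q.prod Q
  have hSm : ∀ e, Measurable (S e) := fun e => by
    refine measurable_iSup_of_continuous fun f => continuous_signedSum_comp lam e fun i => ?_
    have := (hF f f.2).1
    fun_prop
  have hdecouple : ∫⁻ u, ⨆ f : F, ENNReal.ofReal (Real.exp
      (lam * ∑ i, ((f : E → ℝ) (u i) - ∫ x, (f : E → ℝ) x ∂Q))) ∂μ ≤ ∫⁻ z, S 1 z ∂ν := by
    have hmp := (measurePreserving_arrowProdEquivProdArrow E E ι (fun _ => Q) (fun _ => Q)).symm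
    have hSm' : Measurable fun p => S 1 ((MeasurableEquiv.arrowProdEquivProdArrow E E ι).symm p) :=
      (hSm 1).comp hmp.measurable
    rw [← hmp.lintegral_comp (hSm 1), lintegral_prod _ hSm'.aemeasurable]
    refine lintegral_mono fun u => iSup_le fun f => ?_
    have hfc := (hF f f.2).1
    have hfm := hfc.measurable
    have hg : Measurable fun x => ENNReal.ofReal (Real.exp (-(lam * (f : E → ℝ) x))) :=
      (Real.continuous_exp.measurable.comp (hfm.const_mul lam).neg).ennreal_ofReal
    calc ENNReal.ofReal (Real.exp (lam * ∑ i, ((f : E → ℝ) (u i) - ∫ x, (f : E → ℝ) x ∂Q)))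
        = ENNReal.ofReal (Real.exp (lam * ∑ i, (f : E → ℝ) (u i))) *
            ENNReal.ofReal (Real.exp (-(lam * ∫ x, (f : E → ℝ) x ∂Q))) ^ Fintype.card ι := by
          rw [← ENNReal.ofReal_pow (Real.exp_pos _).le, ← Real.exp_nat_mul,
            ← ENNReal.ofReal_mul (Real.exp_pos _).le, ← Real.exp_add, Finset.sum_sub_distrib,
            Finset.sum_const, Finset.card_univ, nsmul_eq_mul]
          congr 2; ring
      _ ≤ ENNReal.ofReal (Real.exp (lam * ∑ i, (f : E → ℝ) (u i))) *
            (∫⁻ x, ENNReal.ofReal (Real.exp (-(lam * (f : E → ℝ) x))) ∂Q) ^ Fintype.card ι := by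
          gcongr
          exact exp_neg_integral_le Q hfm (hF f f.2).2 lam
      _ = ∫⁻ y, ENNReal.ofReal (Real.exp (lam * ∑ i, (f : E → ℝ) (u i))) *
            ∏ i, ENNReal.ofReal (Real.exp (-(lam * (f : E → ℝ) (y i)))) ∂μ := by
          have hprod : Measurable fun y : ι → E =>
              ∏ i, ENNReal.ofReal (Real.exp (-(lam * (f : E → ℝ) (y i)))) :=
            Finset.measurable_prod _ fun i _ => hg.comp (measurable_pi_apply i)
          rw [lintegral_const_mul _ hprod, lintegral_pi_prod Q hg]
      _ ≤ _ := by
          refine lintegral_mono fun y => le_trans (le_of_eq ?_) (le_iSup (fun f : F =>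
            ENNReal.ofReal (Real.exp (lam * signedSum 1 fun i =>
              (f : E → ℝ) (u i) - (f : E → ℝ) (y i)))) f)
          rw [← ENNReal.ofReal_prod_of_nonneg fun _ _ => (Real.exp_pos _).le,
            ← ENNReal.ofReal_mul (Real.exp_pos _).le, ← Real.exp_sum, ← Real.exp_add]
          congr 2
          rw [Finset.mul_sum, ← Finset.sum_add_distrib, signedSum, Finset.mul_sum]
          refine Finset.sum_congr rfl fun i _ => ?_
          simp only [Pi.one_apply, Units.val_one, Int.cast_one]; ring
  have hswap : ∀ e, ∫⁻ z, S e z ∂ν = ∫⁻ z, S 1 z ∂ν := by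
    intro e
    have hmp : MeasurePreserving (fun (z : ι → E × E) i => if e i = 1 then z i else (z i).swap)
        ν ν := by
      refine measurePreserving_pi (fun _ => Q.prod Q) (fun _ => Q.prod Q)
        (f := fun i x => if e i = 1 then x else x.swap) fun i => ?_
      by_cases h : e i = 1
      · simp only [h, if_true]; exact MeasurePreserving.id _
      · simp only [h, if_false]; exact Measure.measurePreserving_swap
    rw [← hmp.lintegral_comp (hSm 1)]
    refine lintegral_congr fun z => iSup_congr fun f => ?_
    congr 3
    refine Finset.sum_congr rfl fun i _ => ?_
    rcases Int.units_eq_one_or (e i) with h | h <;> simp [h]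
  have hradm : Measurable fun u : ι → E => rademacherExp (2 * lam) F u := by
    refine Finset.measurable_sum _ fun e _ => measurable_iSup_of_continuous fun f =>
      continuous_signedSum_comp _ e fun i => ?_
    have := (hF f f.2).1
    fun_prop
  have hfst : MeasurePreserving (fun (z : ι → E × E) i => (z i).1) ν μ :=
    measurePreserving_pi (fun _ => Q.prod Q) (fun _ => Q) fun _ => measurePreserving_fst
  have hsnd : MeasurePreserving (fun (z : ι → E × E) i => (z i).2) ν μ :=
    measurePreserving_pi (fun _ => Q.prod Q) (fun _ => Q) fun _ => measurePreserving_snd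
  have hsplit : ∀ z : ι → E × E, ∑ e, S e z ≤
      2⁻¹ * rademacherExp (2 * lam) F (fun i => (z i).1) +
        2⁻¹ * rademacherExp (2 * lam) F (fun i => (z i).2) := by
    intro z
    let G : (ι → E) → (ι → ℤˣ) → ℝ≥0∞ := fun u e => ⨆ f : F, ENNReal.ofReal
      (Real.exp (2 * lam * signedSum e fun i => (f : E → ℝ) (u i)))
    have hneg : ∑ e, G (fun i => (z i).2) (-e) = ∑ e, G (fun i => (z i).2) e :=
      Equiv.sum_comp (Equiv.neg (ι → ℤˣ)) _
    change _ ≤ 2⁻¹ * ∑ e, G (fun i => (z i).1) e + 2⁻¹ * ∑ e, G (fun i => (z i).2) e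
    rw [← hneg, Finset.mul_sum, Finset.mul_sum, ← Finset.sum_add_distrib]
    refine Finset.sum_le_sum fun e _ => iSup_le fun f => ?_
    have hle : ∀ a b : ℝ, ENNReal.ofReal (Real.exp (a + b)) ≤
        2⁻¹ * ENNReal.ofReal (Real.exp (2 * a)) + 2⁻¹ * ENNReal.ofReal (Real.exp (2 * b)) := by
      intro a b
      have h2 : (2⁻¹ : ℝ≥0∞) = ENNReal.ofReal 2⁻¹ := by
        rw [ENNReal.ofReal_inv_of_pos (by norm_num)]; simp
      rw [h2, ← ENNReal.ofReal_mul (by norm_num), ← ENNReal.ofReal_mul (by norm_num),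
        ← ENNReal.ofReal_add (by positivity) (by positivity)]
      refine ENNReal.ofReal_le_ofReal ?_
      rw [Real.exp_add, two_mul, two_mul, Real.exp_add, Real.exp_add]
      nlinarith [sq_nonneg (Real.exp a - Real.exp b)]
    have heq : lam * signedSum e (fun i => (f : E → ℝ) (z i).1 - (f : E → ℝ) (z i).2) =
        lam * signedSum e (fun i => (f : E → ℝ) (z i).1) +
          lam * signedSum (-e) (fun i => (f : E → ℝ) (z i).2) := by
      rw [signedSum_neg]
      simp only [signedSum, mul_sub, Finset.sum_sub_distrib]
      ring
    rw [heq]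
    refine (hle _ _).trans ?_
    rw [← mul_assoc, ← mul_assoc]
    gcongr
    · exact le_iSup (fun f : F => ENNReal.ofReal
        (Real.exp (2 * lam * signedSum e fun i => (f : E → ℝ) (z i).1))) f
    · exact le_iSup (fun f : F => ENNReal.ofReal
        (Real.exp (2 * lam * signedSum (-e) fun i => (f : E → ℝ) (z i).2))) f
  calc _ ≤ 2 ^ Fintype.card ι * ∫⁻ z, S 1 z ∂ν := by gcongr
    _ = ∑ e, ∫⁻ z, S e z ∂ν := by simp [hswap, Fintype.card_units_int]
    _ = ∫⁻ z, ∑ e, S e z ∂ν := (lintegral_finsetSum _ fun e _ => hSm e).symm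
    _ ≤ ∫⁻ z, (2⁻¹ * rademacherExp (2 * lam) F (fun i => (z i).1) +
          2⁻¹ * rademacherExp (2 * lam) F (fun i => (z i).2)) ∂ν := lintegral_mono hsplit
    _ = 2⁻¹ * ∫⁻ u, rademacherExp (2 * lam) F u ∂μ +
          2⁻¹ * ∫⁻ u, rademacherExp (2 * lam) F u ∂μ := by
        have h1 : Measurable fun z : ι → E × E => rademacherExp (2 * lam) F fun i => (z i).1 :=
          hradm.comp hfst.measurable
        have h2 : Measurable fun z : ι → E × E => rademacherExp (2 * lam) F fun i => (z i).2 :=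
          hradm.comp hsnd.measurable
        rw [lintegral_add_left (h1.const_mul _), lintegral_const_mul _ h1,
          lintegral_const_mul _ h2, hfst.lintegral_comp hradm, hsnd.lintegral_comp hradm]
    _ = _ := by rw [← add_mul, ENNReal.inv_two_add_inv_two, one_mul]

/-! ### The Gaussian linear model -/

section Model

variable {p : ℕ}

open Matrix in
theorem quadForm_bounds {θ : Param p} {B₁ B₂ B₃ : ℝ} (hθ : θ ∈ paramSpace p B₁ B₂ B₃)
    (a : EuclideanSpace ℝ (Fin p)) :
    B₂ * ‖a‖ ^ 2 ≤ a ⬝ᵥ θ.2 *ᵥ a ∧ a ⬝ᵥ θ.2 *ᵥ a ≤ B₃ * ‖a‖ ^ 2 := by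
  obtain ⟨-, -, hlow, hup⟩ := hθ
  have hsq : (a : Fin p → ℝ) ⬝ᵥ a = ‖a‖ ^ 2 := by
    rw [EuclideanSpace.real_norm_sq_eq]
    simp [dotProduct, sq]
  constructor
  · have h := hlow.dotProduct_mulVec_nonneg (a : Fin p → ℝ)
    simp only [star_trivial, sub_mulVec, smul_mulVec, one_mulVec, dotProduct_sub, dotProduct_smul,
      smul_eq_mul, hsq] at h
    linarith
  · have h : inner ℝ a (Matrix.toEuclideanCLM (𝕜 := ℝ) θ.2 a) = a ⬝ᵥ θ.2 *ᵥ a := by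
      rw [inner_toEuclideanCLM]
    rw [← h]
    calc inner ℝ a (Matrix.toEuclideanCLM (𝕜 := ℝ) θ.2 a)
        ≤ ‖a‖ * ‖Matrix.toEuclideanCLM (𝕜 := ℝ) θ.2 a‖ := real_inner_le_norm _ _
      _ ≤ ‖a‖ * (B₃ * ‖a‖) := by
          gcongr
          exact (ContinuousLinearMap.le_opNorm _ _).trans (by gcongr)
      _ = _ := by ring

theorem measurable_model_map (β : EuclideanSpace ℝ (Fin p)) :
    Measurable fun z : EuclideanSpace ℝ (Fin p) × ℝ => WithLp.toLp 2 (z.1, inner ℝ z.1 β + z.2) := by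
  have : Continuous fun z : EuclideanSpace ℝ (Fin p) × ℝ =>
      WithLp.toLp 2 (z.1, inner ℝ z.1 β + z.2) := by fun_prop
  exact this.measurable

instance isProbabilityMeasure_modelLaw (θ : Param p) : IsProbabilityMeasure (modelLaw θ) :=
  Measure.isProbabilityMeasure_map (measurable_model_map θ.1).aemeasurable

open Matrix in
theorem multivariateGaussian_map_inner {S : Matrix (Fin p) (Fin p) ℝ} (hS : S.PosSemidef)
    (a : EuclideanSpace ℝ (Fin p)) :
    (multivariateGaussian 0 S).map (fun x => inner ℝ a x) =
      gaussianReal 0 (a ⬝ᵥ S *ᵥ a).toNNReal := by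
  have h := IsGaussian.map_eq_gaussianReal (μ := multivariateGaussian 0 S) (innerSL ℝ a)
  have hv : Var[innerSL ℝ a; multivariateGaussian 0 S] = a ⬝ᵥ S *ᵥ a := by
    rw [← covarianceBilin_multivariateGaussian (μ := 0) hS,
      covarianceBilin_self IsGaussian.memLp_two_id]
    rfl
  rw [hv, ContinuousLinearMap.integral_comp_id_comm IsGaussian.integrable_id,
    integral_id_multivariateGaussian, map_zero] at h
  exact h

open Matrix in
/-- The linear functional `⟨w, ·⟩` is a centred Gaussian under the model. -/
theorem modelLaw_map_inner {θ : Param p} (hS : θ.2.PosSemidef) (w : Obs p) :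
    (modelLaw θ).map (fun x => inner ℝ w x) =
      gaussianReal 0 (((w.fst + w.snd • θ.1) ⬝ᵥ θ.2 *ᵥ (w.fst + w.snd • θ.1 :
        EuclideanSpace ℝ (Fin p))).toNNReal + (w.snd ^ 2).toNNReal) := by
  have hw : Continuous fun x : Obs p => inner ℝ w x := by fun_prop
  -- With `y = ⟨x, β⟩ + ξ`, the functional becomes `⟨a, x⟩ + w.snd * ξ`, a sum of independent
  -- Gaussians.
  set a : EuclideanSpace ℝ (Fin p) := w.fst + w.snd • θ.1 with ha
  have ham : Measurable fun x : EuclideanSpace ℝ (Fin p) => inner ℝ a x := by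
    have : Continuous fun x : EuclideanSpace ℝ (Fin p) => inner ℝ a x := by fun_prop
    exact this.measurable
  rw [modelLaw, Measure.map_map hw.measurable (measurable_model_map θ.1)]
  have hcomp : (fun x : Obs p => inner ℝ w x) ∘ (fun z : EuclideanSpace ℝ (Fin p) × ℝ =>
      WithLp.toLp 2 (z.1, inner ℝ z.1 θ.1 + z.2)) =
      (fun q : ℝ × ℝ => q.1 + q.2) ∘ Prod.map (fun x => inner ℝ a x) (fun y => w.snd * y) := by
    funext z
    simp only [Function.comp, WithLp.prod_inner_apply, Prod.map, ha, inner_add_left,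
      real_inner_smul_left, real_inner_comm θ.1]
    simp only [WithLp.fst, WithLp.snd, RCLike.inner_apply, conj_trivial]
    ring
  rw [hcomp, ← Measure.map_map (by fun_prop) (ham.prodMap (by fun_prop)),
    ← Measure.map_prod_map _ _ ham (by fun_prop), multivariateGaussian_map_inner hS,
    gaussianReal_map_const_mul]
  have := gaussianReal_conv_gaussianReal (m₁ := 0) (m₂ := 0) (v₁ := (a ⬝ᵥ θ.2 *ᵥ a).toNNReal)
    (v₂ := (w.snd ^ 2).toNNReal)
  rw [Measure.conv, add_zero] at this
  rw [← this, mul_zero, mul_one, Real.toNNReal_of_nonneg (sq_nonneg w.snd)]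

theorem modelLaw_exp_inner_le {B₁ B₂ B₃ : ℝ} {θ : Param p} (hθ : θ ∈ paramSpace p B₁ B₂ B₃)
    (w : Obs p) :
    ∫⁻ x, ENNReal.ofReal (Real.exp (inner ℝ w x)) ∂(modelLaw θ) ≤
      ENNReal.ofReal (Real.exp ((√(B₃ * (1 + B₁) ^ 2 + 1)) ^ 2 * ‖w‖ ^ 2 / 2)) := by
  have hB₁ : 0 ≤ B₁ := (norm_nonneg _).trans hθ.1
  have hB₃ : 0 ≤ B₃ := (norm_nonneg _).trans hθ.2.2.2
  have hwm : Measurable fun x : Obs p => inner ℝ w x := by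
    have : Continuous fun x : Obs p => inner ℝ w x := by fun_prop
    exact this.measurable
  have hem : Measurable fun t : ℝ => ENNReal.ofReal (Real.exp t) :=
    Real.continuous_exp.measurable.ennreal_ofReal
  rw [← lintegral_map hem hwm, modelLaw_map_inner hθ.2.1]
  set a : EuclideanSpace ℝ (Fin p) := w.fst + w.snd • θ.1 with ha
  obtain ⟨hlow, hup⟩ := quadForm_bounds hθ a
  set v := (a ⬝ᵥ θ.2.mulVec a).toNNReal + (w.snd ^ 2).toNNReal with hv
  have hint : Integrable Real.exp (gaussianReal 0 v) := by
    simpa using integrable_exp_mul_gaussianReal (μ := 0) (v := v) 1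
  have hmgf : ∫ t, Real.exp t ∂(gaussianReal 0 v) = Real.exp (v / 2) := by
    simpa [mgf] using congrFun (mgf_id_gaussianReal (μ := 0) (v := v)) 1
  rw [← ofReal_integral_eq_lintegral_ofReal hint (.of_forall fun _ => (Real.exp_pos _).le), hmgf]
  refine ENNReal.ofReal_le_ofReal (Real.exp_le_exp.2 ?_)
  have hnorm := WithLp.prod_norm_sq_eq_of_L2 w
  have hfst : ‖w.fst‖ ≤ ‖w‖ := by
    refine abs_le_of_sq_le_sq' ?_ (norm_nonneg _) |>.2
    rw [hnorm]; linarith [sq_nonneg ‖w.snd‖]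
  have hsnd : ‖w.snd‖ ≤ ‖w‖ := by
    refine abs_le_of_sq_le_sq' ?_ (norm_nonneg _) |>.2
    rw [hnorm]; linarith [sq_nonneg ‖w.fst‖]
  have hanorm : ‖a‖ ≤ (1 + B₁) * ‖w‖ := by
    refine (norm_add_le _ _).trans ?_
    rw [norm_smul]
    nlinarith [mul_le_mul hsnd hθ.1 (norm_nonneg _) (norm_nonneg _)]
  have hvle : (v : ℝ) ≤ (B₃ * (1 + B₁) ^ 2 + 1) * ‖w‖ ^ 2 := by
    rw [hv, NNReal.coe_add, Real.coe_toNNReal', Real.coe_toNNReal _ (sq_nonneg _),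
      ← sq_abs, ← Real.norm_eq_abs, add_mul, one_mul, mul_assoc, ← mul_pow]
    refine add_le_add (max_le (hup.trans ?_) (by positivity)) (by gcongr)
    gcongr
  rw [Real.sq_sqrt (by positivity)]
  linarith

end Model

/-! ### Separation of the model parameters by a single sigmoid node -/

/-- Averaging over the symmetry of the Gaussian leaves a function of `cosh c` that increases with
`|c|`. With bias `0` the sum would be constant. -/
theorem sigmoid_symm_sum (c : ℝ) :
    Real.sigmoid (c - 1) + Real.sigmoid (-c - 1) =
      1 - (Real.exp 1 ^ 2 - 1) / (1 + Real.exp 1 ^ 2 + 2 * Real.exp 1 * Real.cosh c) := by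
  have h1 : Real.exp (-(c - 1)) = Real.exp 1 * (Real.exp c)⁻¹ := by
    rw [← Real.exp_neg, ← Real.exp_add]; congr 1; ring
  have h2 : Real.exp (-(-c - 1)) = Real.exp 1 * Real.exp c := by
    rw [← Real.exp_add]; congr 1; ring
  rw [Real.sigmoid_def, Real.sigmoid_def, h1, h2, Real.cosh_eq, Real.exp_neg c]
  have hc := Real.exp_pos c
  have he := Real.exp_pos 1
  generalize Real.exp c = x at *
  generalize Real.exp 1 = q at *
  have : 0 < x + q := by positivity
  have : 0 < 1 + q * x := by positivity
  have : 1 + q ^ 2 + 2 * q * ((x + x⁻¹) / 2) = (x + q) * (1 + q * x) / x := by field_simp; ring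
  rw [this]
  field_simp
  ring

/-- The difference equals `2 sinh ((a + b) / 2) sinh ((a - b) / 2)`, and `sinh x ≥ x` for `x ≥ 0`.
-/
theorem sq_sub_sq_le_cosh_sub_cosh {a b : ℝ} (hb : 0 ≤ b) (hab : b ≤ a) :
    (a ^ 2 - b ^ 2) / 2 ≤ Real.cosh a - Real.cosh b := by
  have h1 := Real.cosh_add ((a + b) / 2) ((a - b) / 2)
  have h2 := Real.cosh_sub ((a + b) / 2) ((a - b) / 2)
  rw [show (a + b) / 2 + (a - b) / 2 = a by ring] at h1
  rw [show (a + b) / 2 - (a - b) / 2 = b by ring] at h2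
  have h3 : (a + b) / 2 ≤ Real.sinh ((a + b) / 2) := Real.self_le_sinh_iff.2 (by linarith)
  have h4 : (a - b) / 2 ≤ Real.sinh ((a - b) / 2) := Real.self_le_sinh_iff.2 (by linarith)
  have := mul_le_mul h3 h4 (by linarith) (by linarith)
  nlinarith

theorem exists_sigmoid_sum_gap (s₀ : ℝ) : ∃ κ : ℝ, 0 < κ ∧ ∀ s : ℝ, 1 ≤ s → s ≤ s₀ → ∀ t : ℝ,
    (0 ≤ (Real.sigmoid (√s * t - 1) + Real.sigmoid (-(√s * t) - 1)) -
      (Real.sigmoid (t - 1) + Real.sigmoid (-t - 1))) ∧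
    (t ∈ Set.Icc (1 / 2 : ℝ) 1 → κ * (s - 1) ≤
      (Real.sigmoid (√s * t - 1) + Real.sigmoid (-(√s * t) - 1)) -
      (Real.sigmoid (t - 1) + Real.sigmoid (-t - 1))) := by
  set q := Real.exp 1 with hq
  have hq1 : 1 < q := by rw [hq]; exact Real.one_lt_exp_iff.2 one_pos
  set A := Real.cosh √s₀
  have hA : 0 < A := Real.cosh_pos _
  set den : ℝ → ℝ := fun c => 1 + q ^ 2 + 2 * q * Real.cosh c with hden
  have hdpos : ∀ c, 0 < den c := fun c => by
    have := Real.cosh_pos c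
    simp only [hden]; positivity
  have hdiff : ∀ c c' : ℝ, (Real.sigmoid (c - 1) + Real.sigmoid (-c - 1)) -
      (Real.sigmoid (c' - 1) + Real.sigmoid (-c' - 1)) =
      (q ^ 2 - 1) * (2 * q) * (Real.cosh c - Real.cosh c') / (den c * den c') := by
    intro c c'
    rw [sigmoid_symm_sum, sigmoid_symm_sum]
    have e1 := (hdpos c).ne'
    have e2 := (hdpos c').ne'
    change 1 - (q ^ 2 - 1) / den c - (1 - (q ^ 2 - 1) / den c') = _
    rw [eq_div_iff (mul_ne_zero e1 e2)]
    have : (1 - (q ^ 2 - 1) / den c - (1 - (q ^ 2 - 1) / den c')) * (den c * den c') =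
        (q ^ 2 - 1) * (den c - den c') := by field_simp; ring
    rw [this]; simp only [hden]; ring
  have hq2 : 0 < (q ^ 2 - 1) * (2 * q) := by
    have : 0 < q ^ 2 - 1 := by nlinarith
    positivity
  refine ⟨(q ^ 2 - 1) * (2 * q) / 8 / (1 + q ^ 2 + 2 * q * A) ^ 2, by positivity,
    fun s hs1 hs t => ?_⟩
  have hsqrt : 1 ≤ √s := Real.one_le_sqrt.2 hs1
  have hcosh : Real.cosh t ≤ Real.cosh (√s * t) := by
    rw [Real.cosh_le_cosh, abs_mul, abs_of_nonneg (Real.sqrt_nonneg s)]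
    exact le_mul_of_one_le_left (abs_nonneg _) hsqrt
  rw [hdiff]
  constructor
  · have := hdpos (√s * t)
    have := hdpos t
    have : 0 ≤ Real.cosh (√s * t) - Real.cosh t := by linarith
    positivity
  · rintro ⟨ht1, ht2⟩
    have ht0 : 0 ≤ t := by linarith
    have hgap := sq_sub_sq_le_cosh_sub_cosh ht0 (le_mul_of_one_le_left ht0 hsqrt)
    rw [mul_pow, Real.sq_sqrt (by linarith)] at hgap
    have hgap' : (s - 1) / 8 ≤ Real.cosh (√s * t) - Real.cosh t := by
      nlinarith [mul_nonneg (sub_nonneg.2 hs1) (show 0 ≤ t ^ 2 - 1 / 4 by nlinarith)]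
    have hst : Real.cosh (√s * t) ≤ A := by
      rw [Real.cosh_le_cosh, abs_of_nonneg (by positivity), abs_of_nonneg (Real.sqrt_nonneg _)]
      exact (mul_le_of_le_one_right (Real.sqrt_nonneg _) ht2).trans (Real.sqrt_le_sqrt hs)
    have d1 : den (√s * t) ≤ 1 + q ^ 2 + 2 * q * A := by simp only [hden]; gcongr
    have d2 : den t ≤ 1 + q ^ 2 + 2 * q * A := by
      simp only [hden]; gcongr; exact hcosh.trans hst
    have p1 := hdpos (√s * t)
    have p2 := hdpos t
    calc _ = (q ^ 2 - 1) * (2 * q) * ((s - 1) / 8) /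
          ((1 + q ^ 2 + 2 * q * A) * (1 + q ^ 2 + 2 * q * A)) := by rw [sq (1 + q ^ 2 + 2 * q * A)]; ring
      _ ≤ _ := by gcongr

/-- Write both laws as rescalings of one standard Gaussian and symmetrize. The integrand is
nonnegative everywhere and of order `s - 1` on `[1/2, 1]`, a set of positive mass. -/
theorem exists_gaussian_sigmoid_gap (s₀ : ℝ) : ∃ κ : ℝ, 0 < κ ∧ ∀ s : ℝ, 1 ≤ s → s ≤ s₀ →
    κ * (s - 1) ≤ (∫ t, Real.sigmoid (t - 1) ∂(gaussianReal 0 s.toNNReal)) -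
      ∫ t, Real.sigmoid (t - 1) ∂(gaussianReal 0 1) := by
  obtain ⟨κ, hκ, hgap⟩ := exists_sigmoid_sum_gap s₀
  set γ := gaussianReal 0 1
  have hm : 0 < γ.real (Set.Icc (1 / 2 : ℝ) 1) := by
    refine ENNReal.toReal_pos (fun h => ?_) (measure_ne_top _ _)
    have := gaussianReal_absolutelyContinuous' 0 one_ne_zero h
    rw [Real.volume_Icc] at this
    norm_num at this
  refine ⟨κ / 2 * γ.real (Set.Icc (1 / 2 : ℝ) 1), by positivity, fun s hs1 hs => ?_⟩
  have hint : ∀ c : ℝ, Integrable (fun t => Real.sigmoid (c * t - 1)) γ := fun c => by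
    have hc : Continuous fun t => Real.sigmoid (c * t - 1) :=
      continuous_sigmoid.comp (by fun_prop)
    refine .of_bound hc.aestronglyMeasurable 1 (.of_forall fun t => ?_)
    rw [Real.norm_of_nonneg (Real.sigmoid_nonneg _)]
    exact Real.sigmoid_le_one _
  have hscale : ∫ t, Real.sigmoid (t - 1) ∂(gaussianReal 0 s.toNNReal) =
      ∫ t, Real.sigmoid (√s * t - 1) ∂γ := by
    have h := gaussianReal_map_const_mul (μ := 0) (v := 1) √s
    have hv : (⟨√s ^ 2, sq_nonneg _⟩ : NNReal) * 1 = s.toNNReal := by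
      ext; simp [Real.sq_sqrt (show 0 ≤ s by linarith), show 0 ≤ s by linarith]
    rw [mul_zero] at h
    have hc : Continuous fun t => Real.sigmoid (t - 1) := continuous_sigmoid.comp (by fun_prop)
    rw [← hv]
    erw [← h]
    rw [integral_map (by fun_prop) hc.aestronglyMeasurable]
  have hneg : ∀ c : ℝ, ∫ t, Real.sigmoid (-(c * t) - 1) ∂γ = ∫ t, Real.sigmoid (c * t - 1) ∂γ := by
    intro c
    have h := gaussianReal_map_neg (μ := 0) (v := 1)
    rw [neg_zero] at h
    have hc : Continuous fun t => Real.sigmoid (c * t - 1) := continuous_sigmoid.comp (by fun_prop)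
    conv_rhs => rw [show γ = γ.map (fun x => -x) from h.symm]
    rw [integral_map (by fun_prop) hc.aestronglyMeasurable]
    simp
  have hint' : ∀ c : ℝ, Integrable (fun t => Real.sigmoid (-(c * t) - 1)) γ := fun c => by
    simpa using hint (-c)
  have h1 : (∫ t, Real.sigmoid (√s * t - 1) ∂γ) - ∫ t, Real.sigmoid (t - 1) ∂γ =
      2⁻¹ * ∫ t, ((Real.sigmoid (√s * t - 1) + Real.sigmoid (-(√s * t) - 1)) -
      (Real.sigmoid (t - 1) + Real.sigmoid (-t - 1))) ∂γ := by
    have i1 := hint 1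
    have i2 := hint' 1
    have n1 := hneg 1
    simp only [one_mul] at i1 i2 n1
    have j1 : Integrable (fun t => Real.sigmoid (√s * t - 1) + Real.sigmoid (-(√s * t) - 1)) γ :=
      (hint _).add (hint' _)
    have j2 : Integrable (fun t => Real.sigmoid (t - 1) + Real.sigmoid (-t - 1)) γ := i1.add i2
    rw [integral_sub j1 j2, integral_add (hint _) (hint' _),
      integral_add i1 i2, hneg, n1]
    ring
  have h2 : κ * (s - 1) * γ.real (Set.Icc (1 / 2 : ℝ) 1) ≤
      ∫ t, ((Real.sigmoid (√s * t - 1) + Real.sigmoid (-(√s * t) - 1)) -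
      (Real.sigmoid (t - 1) + Real.sigmoid (-t - 1))) ∂γ := by
    have i1 := hint 1
    have i2 := hint' 1
    simp only [one_mul] at i1 i2
    have hind : ∫ t, (Set.Icc (1 / 2 : ℝ) 1).indicator (fun _ => κ * (s - 1)) t ∂γ =
        κ * (s - 1) * γ.real (Set.Icc (1 / 2 : ℝ) 1) := by
      rw [integral_indicator_const _ measurableSet_Icc, smul_eq_mul, mul_comm]
    rw [← hind]
    refine integral_mono ((integrable_const _).indicator measurableSet_Icc)
      (((hint _).add (hint' _)).sub (i1.add i2)) fun t => ?_
    by_cases ht : t ∈ Set.Icc (1 / 2 : ℝ) 1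
    · rw [Set.indicator_of_mem ht]; exact (hgap s hs1 hs t).2 ht
    · rw [Set.indicator_of_notMem ht]; exact (hgap s hs1 hs t).1
  rw [hscale, h1]
  linarith

theorem exists_firstLayer_separation (B₁ B₂ B₃ : ℝ) (hB₂ : 0 < B₂) : ∃ κ : ℝ, 0 < κ ∧
    ∀ (p : ℕ), ∀ θ ∈ paramSpace p B₁ B₂ B₃, ∀ θ' ∈ paramSpace p B₁ B₂ B₃,
      ∃ f ∈ firstLayer (Obs p) (B₁ + 1),
        κ * ‖θ.1 - θ'.1‖ ^ 2 ≤ ∫ x, f x ∂(modelLaw θ') - ∫ x, f x ∂(modelLaw θ) := by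
  obtain ⟨κ, hκ, hgap⟩ := exists_gaussian_sigmoid_gap (1 + B₃ * (2 * B₁) ^ 2)
  refine ⟨κ * B₂, by positivity, fun p θ hθ θ' hθ' => ?_⟩
  have hB₁ : 0 ≤ B₁ := (norm_nonneg _).trans hθ.1
  have hB₃ : 0 ≤ B₃ := (norm_nonneg _).trans hθ.2.2.2
  -- This `w` reads off the residual `y - ⟨x, θ.1⟩`; its norm is the reason for the weight bound `B₁
  -- + 1`.
  let w : Obs p := WithLp.toLp 2 (-θ.1, 1)
  have hwnorm : ‖w‖ ≤ B₁ + 1 := by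
    refine (sq_le_sq₀ (norm_nonneg _) (by linarith)).1 ?_
    rw [WithLp.prod_norm_sq_eq_of_L2]
    simp only [w, WithLp.fst, WithLp.snd, norm_neg, norm_one]
    nlinarith [hθ.1, norm_nonneg θ.1]
  refine ⟨fun x => Real.sigmoid (inner ℝ w x + -1), ⟨w, -1, hwnorm, rfl⟩, ?_⟩
  have hwm : Measurable fun x : Obs p => inner ℝ w x := by
    have : Continuous fun x : Obs p => inner ℝ w x := by fun_prop
    exact this.measurable
  have hsig : Continuous fun t => Real.sigmoid (t - 1) := continuous_sigmoid.comp (by fun_prop)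
  have hlaw : ∀ θ'' ∈ paramSpace p B₁ B₂ B₃,
      ∫ x, Real.sigmoid (inner ℝ w x + -1) ∂(modelLaw θ'') =
        ∫ t, Real.sigmoid (t - 1) ∂(gaussianReal 0 (1 + (θ''.1 - θ.1) ⬝ᵥ
          θ''.2.mulVec (θ''.1 - θ.1 : EuclideanSpace ℝ (Fin p))).toNNReal) := by
    intro θ'' hθ''
    have h := modelLaw_map_inner hθ''.2.1 w
    have ha : w.fst + w.snd • θ''.1 = θ''.1 - θ.1 := by
      simp only [w, WithLp.fst, WithLp.snd, one_smul]; abel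
    have hq : 0 ≤ (θ''.1 - θ.1) ⬝ᵥ θ''.2.mulVec (θ''.1 - θ.1 : EuclideanSpace ℝ (Fin p)) :=
      (by positivity : 0 ≤ B₂ * ‖θ''.1 - θ.1‖ ^ 2).trans (quadForm_bounds hθ'' _).1
    have h1 : w.snd ^ 2 = 1 := by simp [w, WithLp.snd]
    rw [ha, h1, add_comm, ← Real.toNNReal_add zero_le_one hq] at h
    rw [← h, integral_map hwm.aemeasurable hsig.aestronglyMeasurable]
    rfl
  rw [hlaw θ' hθ', hlaw θ hθ]
  obtain ⟨hlow, hup⟩ := quadForm_bounds hθ' (θ'.1 - θ.1)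
  set q := (θ'.1 - θ.1) ⬝ᵥ θ'.2.mulVec (θ'.1 - θ.1 : EuclideanSpace ℝ (Fin p)) with hq
  have hd : ‖θ'.1 - θ.1‖ ≤ 2 * B₁ := (norm_sub_le _ _).trans (by linarith [hθ.1, hθ'.1])
  have h0 : (θ.1 - θ.1) ⬝ᵥ θ.2.mulVec (θ.1 - θ.1 : EuclideanSpace ℝ (Fin p)) = 0 := by simp
  have hq0 : 0 ≤ q := (by positivity : 0 ≤ B₂ * ‖θ'.1 - θ.1‖ ^ 2).trans hlow
  have hqup : q ≤ B₃ * (2 * B₁) ^ 2 := hup.trans (by gcongr)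
  have := hgap (1 + q) (by linarith) (by linarith)
  rw [h0, add_zero, Real.toNNReal_one, norm_sub_rev]
  refine le_trans ?_ this
  rw [add_sub_cancel_left, mul_assoc]
  gcongr

/-! ### Optimality of the estimator -/

theorem sub_integral_le_of_isEstimate {p n : ℕ} (hn : 0 < n) {B : ℝ} (hB : 0 ≤ B) {d : ℕ → ℕ}
    {L : ℕ} {S : Set (Param p)} {θ θhat : Param p} (hθ : θ ∈ S) {z : Fin n → Obs p}
    (hest : IsEstimate (discriminator (Obs p) B d L) S z θhat) {t : ℝ}
    (ht : ∀ f ∈ discriminator (Obs p) B d L, (∑ i, f (z i)) / n - ∫ x, f x ∂(modelLaw θ) ≤ t)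
    {f : Obs p → ℝ} (hf : f ∈ discriminator (Obs p) B d L) :
    ∫ x, f x ∂(modelLaw θhat) - ∫ x, f x ∂(modelLaw θ) ≤ 2 * t := by
  set D := discriminator (Obs p) B d L
  have hn' : (0 : ℝ) < n := Nat.cast_pos.2 hn
  have : Nonempty D := ⟨⟨f, hf⟩⟩
  have hint : ∀ g ∈ D, Integrable g (modelLaw θhat) := fun g hg =>
    .of_bound (continuous_of_mem_discriminator hB hg).aestronglyMeasurable 1
      (.of_forall (discriminator_bound hB g hg).1)
  have hobj : objective D z (modelLaw θhat) ≤ t :=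
    (hest.2 θ hθ).trans (ciSup_le fun g => ht g g.2)
  -- A real `⨆` dominates its terms only when the family is bounded above; here `|f| ≤ 1` suffices.
  have hbdd : BddAbove (Set.range fun g : D =>
      (∑ i, (g : Obs p → ℝ) (z i)) / n - ∫ x, (g : Obs p → ℝ) x ∂(modelLaw θhat)) := by
    refine ⟨1 + 1, ?_⟩
    rintro _ ⟨g, rfl⟩
    have hb := (discriminator_bound hB _ g.2).1
    have h1 : (∑ i, (g : Obs p → ℝ) (z i)) / n ≤ 1 := by
      rw [div_le_one hn']
      calc ∑ i, (g : Obs p → ℝ) (z i) ≤ ∑ _i : Fin n, (1 : ℝ) :=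
            Finset.sum_le_sum fun i _ => (abs_le.1 (hb _)).2
        _ = n := by simp
    have h2 : -1 ≤ ∫ x, (g : Obs p → ℝ) x ∂(modelLaw θhat) := by
      have := norm_integral_le_of_norm_le_const (μ := modelLaw θhat)
        (f := (g : Obs p → ℝ)) (C := 1) (.of_forall hb)
      rw [probReal_univ, mul_one] at this
      exact (abs_le.1 this).1
    linarith
  have hhat : ∀ g ∈ D, (∑ i, g (z i)) / n - ∫ x, g x ∂(modelLaw θhat) ≤ t := fun g hg =>
    (le_ciSup hbdd ⟨g, hg⟩).trans hobj
  -- The reflected function turns the bound on the fitted objective into `∫ f ∂(modelLaw θhat) - P_n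
  -- f ≤ t`; the one-sided deviation at `θ` supplies the other half.
  obtain ⟨c, hc⟩ := exists_const_sub_mem_discriminator hf
  have h1 := hhat _ hc
  have h2 := ht f hf
  rw [integral_sub (integrable_const c) (hint f hf), integral_const, probReal_univ, one_smul,
    Finset.sum_sub_distrib, Finset.sum_const, Finset.card_univ, Fintype.card_fin, nsmul_eq_mul,
    sub_div, mul_div_cancel_left₀ _ hn'.ne'] at h1
  linarith

/-! ### Concentration under the model and transport to the contaminated sample -/

/-- A uniform deviation inequality for the discriminator class under a subgaussian law. -/
theorem measure_discriminator_deviation_le {E : Type*} [NormedAddCommGroup E]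
    [InnerProductSpace ℝ E] [FiniteDimensional ℝ E] [MeasurableSpace E] [BorelSpace E]
    (Q : Measure E) [IsProbabilityMeasure Q] {B v : ℝ} (hB : 0 ≤ B) (hv : 0 ≤ v)
    (hQ : ∀ w : E, ∫⁻ x, ENNReal.ofReal (Real.exp (inner ℝ w x)) ∂Q ≤
      ENNReal.ofReal (Real.exp (v ^ 2 * ‖w‖ ^ 2 / 2)))
    {d : ℕ → ℕ} (hd : ∀ j, 0 < d j) (L n : ℕ) {t : ℝ} (ht : 0 ≤ t) :
    (Measure.pi fun _ : Fin n => Q) {u | ∃ f ∈ discriminator E B d L,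
        n * t < ∑ i, (f (u i) - ∫ x, f x ∂Q)} ≤
      ENNReal.ofReal (2 ^ L * (2 * (144 * 25 ^ Module.finrank ℝ E) ^ 2) *
        Real.exp (-(n * t ^ 2 / (32 * (16 * (2 + 4 * v * (B + 1))) ^ 2)))) := by
  have : SecondCountableTopology E := by
    have := FiniteDimensional.proper ℝ E
    infer_instance
  set K := 16 * (2 + 4 * v * (B + 1)) with hK
  have hKpos : 0 < K := by positivity
  set F := discriminator E B d L with hF
  set μ : Measure (Fin n → E) := Measure.pi fun _ => Q
  -- The minimizer of the Chernoff exponent `8 n K² lam² - lam n t`.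
  set lam := t / (16 * K ^ 2) with hlam
  have hlam0 : 0 ≤ lam := by positivity
  have hFc : ∀ f ∈ F, Continuous f ∧ ∀ x, |f x| ≤ 1 := fun f hf =>
    ⟨continuous_of_mem_discriminator hB hf, (discriminator_bound hB f hf).1⟩
  set G : (Fin n → E) → ℝ≥0∞ := fun u => ⨆ f : F, ENNReal.ofReal (Real.exp
    (lam * ∑ i, ((f : E → ℝ) (u i) - ∫ x, (f : E → ℝ) x ∂Q))) with hG
  have hGm : Measurable G := measurable_iSup_of_continuous fun f => by
    have := (hFc f f.2).1
    fun_prop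
  have hsub : {u | ∃ f ∈ F, n * t < ∑ i, (f (u i) - ∫ x, f x ∂Q)} ⊆
      {u | ENNReal.ofReal (Real.exp (lam * (n * t))) ≤ G u} := by
    rintro u ⟨f, hf, hlt⟩
    refine le_trans (ENNReal.ofReal_le_ofReal (Real.exp_le_exp.2 ?_)) (le_iSup (fun f : F =>
      ENNReal.ofReal (Real.exp (lam * ∑ i, ((f : E → ℝ) (u i) - ∫ x, (f : E → ℝ) x ∂Q)))) ⟨f, hf⟩)
    gcongr
  have hGint : ∫⁻ u, G u ∂μ ≤ ENNReal.ofReal (2 ^ L * (2 * (144 * 25 ^ Module.finrank ℝ E) ^ 2) *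
      Real.exp (2 * n * K ^ 2 * (2 * lam) ^ 2)) := by
    have h2 : (2 : ℝ≥0∞) ^ n ≠ 0 := by simp
    have h2' : (2 : ℝ≥0∞) ^ n ≠ ⊤ := by simp
    rw [← ENNReal.mul_le_mul_iff_right h2 h2']
    have h := lintegral_iSup_exp_le_rademacherExp (ι := Fin n) Q hFc lam
    rw [Fintype.card_fin] at h
    calc _ ≤ ∫⁻ u, rademacherExp (2 * lam) F u ∂μ := h
      _ ≤ ∫⁻ u, 2 ^ L * rademacherExp (2 * lam) (firstLayer E B) u ∂μ :=
          lintegral_mono fun u => rademacherExp_discriminator_le hB hd (by positivity) u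
      _ = 2 ^ L * ∫⁻ u, rademacherExp (2 * lam) (firstLayer E B) u ∂μ :=
          lintegral_const_mul' _ _ (by simp)
      _ ≤ 2 ^ L * (2 ^ n * ENNReal.ofReal (2 * (144 * 25 ^ Module.finrank ℝ E) ^ 2 *
            Real.exp (2 * n * K ^ 2 * (2 * lam) ^ 2))) := by
          gcongr
          have := lintegral_rademacherExp_firstLayer_le (ι := Fin n) Q hB hv hQ (2 * lam)
          rwa [Fintype.card_fin] at this
      _ = _ := by
          rw [mul_assoc (2 ^ L : ℝ), ENNReal.ofReal_mul (by positivity : (0 : ℝ) ≤ 2 ^ L),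
            ENNReal.ofReal_pow (by norm_num)]
          simp only [ENNReal.ofReal_ofNat]
          ring
  have hexp := Real.exp_pos (lam * (n * t))
  calc μ {u | ∃ f ∈ F, n * t < ∑ i, (f (u i) - ∫ x, f x ∂Q)}
      ≤ μ {u | ENNReal.ofReal (Real.exp (lam * (n * t))) ≤ G u} := measure_mono hsub
    _ ≤ (∫⁻ u, G u ∂μ) / ENNReal.ofReal (Real.exp (lam * (n * t))) :=
        meas_ge_le_lintegral_div hGm.aemeasurable (by simpa using hexp) ENNReal.ofReal_ne_top
    _ ≤ ENNReal.ofReal (2 ^ L * (2 * (144 * 25 ^ Module.finrank ℝ E) ^ 2) *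
          Real.exp (2 * n * K ^ 2 * (2 * lam) ^ 2)) /
          ENNReal.ofReal (Real.exp (lam * (n * t))) := by gcongr
    _ = _ := by
        rw [← ENNReal.ofReal_div_of_pos hexp, mul_div_assoc, ← Real.exp_sub]
        congr 3
        rw [hlam]; field_simp; ring

/-- The infimum is not shown to be attained, hence the slack `η`. -/
theorem exists_coupling {E : Type*} [PseudoEMetricSpace E] [MeasurableSpace E] {P Q : Measure E}
    {ε η : ℝ} (hε : 0 ≤ ε) (hη : 0 < η) (h : wasserstein P Q ≤ ENNReal.ofReal ε) :
    ∃ π : Measure (E × E), π.map Prod.fst = P ∧ π.map Prod.snd = Q ∧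
      ∫⁻ z, edist z.1 z.2 ∂π ≤ ENNReal.ofReal (ε + η) := by
  have hlt : wasserstein P Q < ENNReal.ofReal (ε + η) :=
    h.trans_lt ((ENNReal.ofReal_lt_ofReal_iff (by linarith)).2 (by linarith))
  simp only [wasserstein, iInf_lt_iff] at hlt
  obtain ⟨π, h1, h2, h3⟩ := hlt
  exact ⟨π, h1, h2, h3.le⟩

theorem exp_le_one_add_four_mul {y : ℝ} (h0 : 0 ≤ y) (h2 : y ≤ 2) : Real.exp y ≤ 1 + 4 * y := by
  have h := convexOn_exp.2 (Set.mem_univ (0 : ℝ)) (Set.mem_univ (2 : ℝ))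
    (show 0 ≤ 1 - y / 2 by linarith) (show 0 ≤ y / 2 by linarith) (by ring)
  simp only [smul_eq_mul, mul_zero, zero_add, Real.exp_zero, mul_one] at h
  rw [div_mul_cancel₀ y two_ne_zero] at h
  have he : Real.exp 2 ≤ 9 := by
    have h1 := Real.exp_one_lt_d9
    have : Real.exp 2 = Real.exp 1 * Real.exp 1 := by rw [← Real.exp_add]; norm_num
    rw [this]; nlinarith [Real.exp_pos 1]
  nlinarith

/-- A Chernoff bound for the truncated transport cost of a coupling along an i.i.d. sample. -/
theorem measure_truncated_cost_le {E : Type*} [NormedAddCommGroup E] [MeasurableSpace E]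
    [BorelSpace E] [SecondCountableTopology E] (π : Measure (E × E)) [IsProbabilityMeasure π]
    {B a : ℝ} (hB : 0 ≤ B) (ha : 0 ≤ a)
    (hπ : ∫⁻ z, edist z.1 z.2 ∂π ≤ ENNReal.ofReal a) (n : ℕ) (t : ℝ) :
    (Measure.pi fun _ : Fin n => π) {z | n * t ≤ ∑ i, min 2 (B * ‖(z i).1 - (z i).2‖)} ≤
      ENNReal.ofReal (Real.exp (4 * B * n * a - n * t)) := by
  let Y : E × E → ℝ := fun z => min 2 (B * ‖z.1 - z.2‖)
  have hYc : Continuous Y := by fun_prop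
  have hg : Measurable fun z => ENNReal.ofReal (Real.exp (Y z)) :=
    (Real.continuous_exp.comp hYc).measurable.ennreal_ofReal
  -- Truncation at 2 makes the exponential at most affine in the cost, so the first moment controls
  -- the exponential moment.
  have hone : ∫⁻ z, ENNReal.ofReal (Real.exp (Y z)) ∂π ≤ ENNReal.ofReal (Real.exp (4 * B * a)) := by
    calc ∫⁻ z, ENNReal.ofReal (Real.exp (Y z)) ∂π
        ≤ ∫⁻ z, (1 + ENNReal.ofReal (4 * B) * edist z.1 z.2) ∂π := by
          refine lintegral_mono fun z => ?_
          rw [edist_dist, dist_eq_norm, ← ENNReal.ofReal_mul (by positivity), ← ENNReal.ofReal_one,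
            ← ENNReal.ofReal_add zero_le_one (by positivity)]
          refine ENNReal.ofReal_le_ofReal
            ((exp_le_one_add_four_mul (le_min two_pos.le (by positivity)) (min_le_left _ _)).trans ?_)
          have := min_le_right 2 (B * ‖z.1 - z.2‖)
          linarith
      _ ≤ 1 + ENNReal.ofReal (4 * B) * ENNReal.ofReal a := by
          rw [lintegral_add_left measurable_const, lintegral_const, measure_univ, mul_one,
            lintegral_const_mul' _ _ ENNReal.ofReal_ne_top]
          gcongr
      _ ≤ _ := by
          rw [← ENNReal.ofReal_mul (by positivity), ← ENNReal.ofReal_one,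
            ← ENNReal.ofReal_add zero_le_one (by positivity)]
          refine ENNReal.ofReal_le_ofReal ?_
          linarith [Real.add_one_le_exp (4 * B * a)]
  have hexp := Real.exp_pos (n * t)
  have hprod : ∀ z : Fin n → E × E, ENNReal.ofReal (Real.exp (∑ i, Y (z i))) =
      ∏ i, ENNReal.ofReal (Real.exp (Y (z i))) := fun z => by
    rw [Real.exp_sum, ENNReal.ofReal_prod_of_nonneg fun _ _ => (Real.exp_pos _).le]
  have hm : Measurable fun z : Fin n → E × E => ENNReal.ofReal (Real.exp (∑ i, Y (z i))) := by
    have : Continuous fun z : Fin n → E × E => Real.exp (∑ i, Y (z i)) := by fun_prop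
    exact this.measurable.ennreal_ofReal
  calc (Measure.pi fun _ : Fin n => π) {z | n * t ≤ ∑ i, Y (z i)}
      ≤ (Measure.pi fun _ : Fin n => π)
          {z | ENNReal.ofReal (Real.exp (n * t)) ≤ ENNReal.ofReal (Real.exp (∑ i, Y (z i)))} :=
        measure_mono fun z hz => ENNReal.ofReal_le_ofReal (Real.exp_le_exp.2 hz)
    _ ≤ (∫⁻ z, ENNReal.ofReal (Real.exp (∑ i, Y (z i))) ∂(Measure.pi fun _ : Fin n => π)) /
          ENNReal.ofReal (Real.exp (n * t)) :=
        meas_ge_le_lintegral_div hm.aemeasurable (by simpa using hexp) ENNReal.ofReal_ne_top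
    _ = (∫⁻ z, ENNReal.ofReal (Real.exp (Y z)) ∂π) ^ n / ENNReal.ofReal (Real.exp (n * t)) := by
        simp_rw [hprod]
        rw [lintegral_pi_prod π hg, Fintype.card_fin]
    _ ≤ ENNReal.ofReal (Real.exp (4 * B * a)) ^ n / ENNReal.ofReal (Real.exp (n * t)) := by gcongr
    _ = _ := by
        rw [← ENNReal.ofReal_pow (Real.exp_pos _).le, ← ENNReal.ofReal_div_of_pos hexp,
          ← Real.exp_nat_mul, ← Real.exp_sub]
        congr 3; ring

theorem finrank_obs (p : ℕ) : Module.finrank ℝ (Obs p) = p + 1 := by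
  rw [(WithLp.linearEquiv 2 ℝ (EuclideanSpace ℝ (Fin p) × ℝ)).finrank_eq, Module.finrank_prod,
    finrank_euclideanSpace, Fintype.card_fin, Module.finrank_self]

theorem card_factor_le_exp (p L : ℕ) :
    (2 : ℝ) ^ L * (2 * (144 * 25 ^ (p + 1)) ^ 2) ≤ Real.exp (L + 18 + 7 * p) := by
  have he : (2.7 : ℝ) ≤ Real.exp 1 := by linarith [Real.exp_one_gt_d9]
  have hpow : ∀ (k : ℕ), (2.7 : ℝ) ^ k ≤ Real.exp k := fun k => by
    rw [← Real.exp_one_pow]; gcongr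
  have h2 : (2 : ℝ) ^ L ≤ Real.exp L :=
    (pow_le_pow_left₀ (by norm_num) (by norm_num : (2 : ℝ) ≤ 2.7) L).trans (hpow L)
  have h18 : (2 : ℝ) * (144 * 25) ^ 2 ≤ Real.exp 18 := by
    have := hpow 18
    push_cast at this
    exact le_trans (by norm_num) this
  have h7 : (625 : ℝ) ^ p ≤ Real.exp (7 * p) := by
    have := hpow 7
    push_cast at this
    rw [mul_comm, Real.exp_nat_mul]
    gcongr
    exact le_trans (by norm_num) this
  calc (2 : ℝ) ^ L * (2 * (144 * 25 ^ (p + 1)) ^ 2)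
      = 2 ^ L * (2 * (144 * 25) ^ 2) * 625 ^ p := by
        rw [show (625 : ℝ) ^ p = 25 ^ p * 25 ^ p by rw [← mul_pow]; norm_num, pow_succ]; ring
    _ ≤ Real.exp L * Real.exp 18 * Real.exp (7 * p) := by gcongr
    _ = _ := by rw [← Real.exp_add, ← Real.exp_add]

theorem half_exp_of_le {a b : ℝ} (h : a + 1 ≤ b) : Real.exp (-b) ≤ Real.exp (-a) / 2 := by
  have h1 : Real.exp (-b) ≤ Real.exp (-a) * Real.exp (-1) := by
    rw [← Real.exp_add]; exact Real.exp_le_exp.2 (by linarith)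
  have h2 : Real.exp (-1) ≤ 1 / 2 := by
    rw [Real.exp_neg, one_div]
    exact inv_anti₀ two_pos (by linarith [Real.exp_one_gt_d9])
  nlinarith [Real.exp_pos (-a)]

theorem measurableSet_deviation {E : Type*} [NormedAddCommGroup E] [InnerProductSpace ℝ E]
    [SecondCountableTopology E] [MeasurableSpace E] [BorelSpace E] (Q : Measure E) {B : ℝ}
    (hB : 0 ≤ B) (d : ℕ → ℕ) (L : ℕ) {n : ℕ} (t : ℝ) :
    MeasurableSet {z : Fin n → E | ∃ f ∈ discriminator E B d L,
      n * t < ∑ i, (f (z i) - ∫ x, f x ∂Q)} := by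
  have : {z : Fin n → E | ∃ f ∈ discriminator E B d L, n * t < ∑ i, (f (z i) - ∫ x, f x ∂Q)} =
      ⋃ f ∈ discriminator E B d L, {z | n * t < ∑ i, (f (z i) - ∫ x, f x ∂Q)} := by ext z; simp
  rw [this]
  refine (isOpen_biUnion fun f hf => isOpen_lt continuous_const ?_).measurableSet
  have := continuous_of_mem_discriminator hB hf
  fun_prop

/-- The uniform one-sided deviation of the sample averages from the uncorrupted model. -/
theorem measure_contaminated_deviation_le {p n L : ℕ} (hp : 0 < p) (hn : 0 < n) (hL : 1 ≤ L)
    {d : ℕ → ℕ} (hd : ∀ j, 0 < d j) {ε B v : ℝ} (hε : 0 ≤ ε) (hB : 0 ≤ B) (hv : 0 ≤ v)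
    (hsmall : (2 : ℝ) ^ L * ((p : ℝ) / n) + ε ^ 2 ≤ 1) {P Q : Measure (Obs p)}
    [IsProbabilityMeasure P] [IsProbabilityMeasure Q]
    (hQ : ∀ w : Obs p, ∫⁻ x, ENNReal.ofReal (Real.exp (inner ℝ w x)) ∂Q ≤
      ENNReal.ofReal (Real.exp (v ^ 2 * ‖w‖ ^ 2 / 2)))
    (hW : wasserstein P Q ≤ ENNReal.ofReal ε) :
    (Measure.pi fun _ : Fin n => P) {z | ∃ f ∈ discriminator (Obs p) B d L,
        n * ((43 * (16 * (2 + 4 * v * (B + 1))) + (8 * B + 3)) *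
          max ((2 : ℝ) ^ L * √((p : ℝ) / n)) ε) < ∑ i, (f (z i) - ∫ x, f x ∂Q)} ≤
      ENNReal.ofReal (Real.exp (-((p : ℝ) + n * ε ^ 2))) := by
  have hp' : (1 : ℝ) ≤ p := by exact_mod_cast hp
  have hn' : (0 : ℝ) < n := Nat.cast_pos.2 hn
  set D := discriminator (Obs p) B d L with hD
  set K := 16 * (2 + 4 * v * (B + 1)) with hK
  have hKpos : 0 < K := by positivity
  set r := √((p : ℝ) / n) with hr
  have hr0 : 0 < r := Real.sqrt_pos.2 (by positivity)
  have hr2 : r ^ 2 = p / n := Real.sq_sqrt (by positivity)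
  have hnr : n * r ^ 2 = p := by rw [hr2]; field_simp
  set m := max ((2 : ℝ) ^ L * r) ε with hm
  have h2L : (1 : ℝ) ≤ 2 ^ L := one_le_pow₀ (by norm_num)
  have hmr : r ≤ m := (le_mul_of_one_le_left hr0.le h2L).trans (le_max_left _ _)
  have hmε : ε ≤ m := le_max_right _ _
  have hm0 : 0 < m := hr0.trans_le hmr
  have hm2 : (2 : ℝ) ^ L * p + n * ε ^ 2 ≤ 2 * (n * m ^ 2) := by
    have h1 : 2 ^ L * r * (2 ^ L * r) ≤ m * m := by gcongr <;> exact le_max_left _ _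
    have h2 : ε ^ 2 ≤ m ^ 2 := by gcongr
    have h3 : (2 : ℝ) ^ L * p ≤ n * m ^ 2 := by
      calc (2 : ℝ) ^ L * p = n * (2 ^ L * r ^ 2) := by rw [← hnr]; ring
        _ ≤ n * (2 ^ L * r * (2 ^ L * r)) := by
            refine mul_le_mul_of_nonneg_left ?_ hn'.le
            nlinarith [mul_nonneg (sub_nonneg.2 h2L) (mul_nonneg (zero_le_one.trans h2L)
              (sq_nonneg r))]
        _ ≤ n * m ^ 2 := by rw [sq m]; gcongr
    nlinarith
  -- The smallness assumption enters only through `r ≤ 1` and `ε ≤ 1`, which let the transport step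
  -- bound squares by first powers.
  have hr1 : r ≤ 1 := by
    refine (sq_le_one_iff₀ hr0.le).1 ?_
    rw [hr2]
    nlinarith [sq_nonneg ε, show 0 ≤ (p : ℝ) / n by positivity]
  have hε1 : ε ≤ 1 := by
    refine (sq_le_one_iff₀ hε).1 ?_
    nlinarith [show 0 ≤ (2 : ℝ) ^ L * ((p : ℝ) / n) by positivity]
  -- The slack `r` is at most `m`, so it does not affect the rate.
  obtain ⟨π, hπ1, hπ2, hπ⟩ := exists_coupling hε hr0 hW
  have : IsProbabilityMeasure π := by
    refine ⟨?_⟩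
    rw [← Set.preimage_univ (f := Prod.fst), ← Measure.map_apply measurable_fst .univ, hπ1,
      measure_univ]
  have hfst : MeasurePreserving (fun (z : Fin n → Obs p × Obs p) i => (z i).1)
      (Measure.pi fun _ => π) (Measure.pi fun _ => P) :=
    measurePreserving_pi (fun _ => π) (fun _ => P) fun _ => ⟨measurable_fst, hπ1⟩
  have hsnd : MeasurePreserving (fun (z : Fin n → Obs p × Obs p) i => (z i).2)
      (Measure.pi fun _ => π) (Measure.pi fun _ => Q) :=
    measurePreserving_pi (fun _ => π) (fun _ => Q) fun _ => ⟨measurable_snd, hπ2⟩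
  let U : ℝ → Set (Fin n → Obs p) := fun t =>
    {z | ∃ f ∈ D, n * t < ∑ i, (f (z i) - ∫ x, f x ∂Q)}
  have hUm : ∀ t, MeasurableSet (U t) := fun t => measurableSet_deviation Q hB d L t
  -- The exponent becomes `43² / 32 * n m²`, ample for the entropy `L + 18 + 7p`, the target `p + n
  -- ε²` and the `1` that halves the probability.
  set t₁ := 43 * K * m with ht₁
  -- `8 * B` covers the mean cost term `4 B (ε + r)`; the `3` covers `p`, `n ε²` and `1`, each at
  -- most `n m`.
  set t₂ := (8 * B + 3) * m with ht₂
  have hgauss : (Measure.pi fun _ : Fin n => Q) (U t₁) ≤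
      ENNReal.ofReal (Real.exp (-((p : ℝ) + n * ε ^ 2)) / 2) := by
    refine (measure_discriminator_deviation_le Q hB hv hQ hd L n
      (by positivity : (0 : ℝ) ≤ t₁)).trans (ENNReal.ofReal_le_ofReal ?_)
    rw [finrank_obs, ← hK]
    refine (mul_le_mul_of_nonneg_right (card_factor_le_exp p L) (Real.exp_pos _).le).trans ?_
    rw [← Real.exp_add, ← neg_neg (_ + _)]
    refine half_exp_of_le ?_
    have hexp : n * t₁ ^ 2 / (32 * K ^ 2) = 1849 / 32 * (n * m ^ 2) := by
      rw [ht₁]; field_simp; ring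
    have hLp : (L : ℝ) ≤ 2 ^ L * p :=
      (show (L : ℝ) ≤ 2 ^ L by exact_mod_cast Nat.lt_two_pow_self.le).trans
        (le_mul_of_one_le_right (by positivity) hp')
    have hpp : (2 : ℝ) * p ≤ 2 ^ L * p := by
      gcongr
      simpa using pow_le_pow_right₀ (one_le_two : (1 : ℝ) ≤ 2) hL
    have : 0 ≤ n * ε ^ 2 := by positivity
    rw [hexp]
    linarith
  have htrans : (Measure.pi fun _ : Fin n => π)
      {z | n * t₂ ≤ ∑ i, min 2 (B * ‖(z i).1 - (z i).2‖)} ≤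
        ENNReal.ofReal (Real.exp (-((p : ℝ) + n * ε ^ 2)) / 2) := by
    refine (measure_truncated_cost_le π hB (by positivity) hπ n t₂).trans
      (ENNReal.ofReal_le_ofReal ?_)
    rw [← neg_neg (4 * B * n * (ε + r) - _)]
    refine half_exp_of_le ?_
    have h1 : 4 * B * n * (ε + r) ≤ 4 * B * n * (m + m) := by gcongr
    have h2 : (p : ℝ) ≤ n * m := by
      rw [← hnr]; gcongr; nlinarith
    have h3 : n * ε ^ 2 ≤ n * m := by gcongr; nlinarith
    rw [ht₂]
    linarith
  have hcover : (fun (z : Fin n → Obs p × Obs p) i => (z i).1) ⁻¹' (U (t₁ + t₂)) ⊆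
      (fun (z : Fin n → Obs p × Obs p) i => (z i).2) ⁻¹' (U t₁) ∪
        {z | n * t₂ ≤ ∑ i, min 2 (B * ‖(z i).1 - (z i).2‖)} := by
    rintro z ⟨f, hf, hlt⟩
    by_contra hcon
    rw [Set.mem_union, not_or] at hcon
    have h1 : ∑ i, (f (z i).2 - ∫ x, f x ∂Q) ≤ n * t₁ := by
      by_contra! h
      exact hcon.1 ⟨f, hf, h⟩
    have h2 : ∑ i, min 2 (B * ‖(z i).1 - (z i).2‖) < n * t₂ := not_le.1 hcon.2
    obtain ⟨hb, hl⟩ := discriminator_bound hB f hf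
    have h3 : ∑ i, (f (z i).1 - ∫ x, f x ∂Q) ≤ ∑ i, (f (z i).2 - ∫ x, f x ∂Q) +
        ∑ i, min 2 (B * ‖(z i).1 - (z i).2‖) := by
      rw [← Finset.sum_add_distrib]
      refine Finset.sum_le_sum fun i _ => ?_
      have : f (z i).1 - f (z i).2 ≤ min 2 (B * ‖(z i).1 - (z i).2‖) :=
        le_min (by linarith [(abs_le.1 (hb (z i).1)).2, (abs_le.1 (hb (z i).2)).1])
          ((le_abs_self _).trans (hl _ _))
      linarith
    simp only at hlt
    linarith
  have hexp := Real.exp_pos (-((p : ℝ) + n * ε ^ 2))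
  rw [add_mul]
  change (Measure.pi fun _ : Fin n => P) (U (t₁ + t₂)) ≤ _
  calc (Measure.pi fun _ : Fin n => P) (U (t₁ + t₂))
      = (Measure.pi fun _ : Fin n => π)
          ((fun (z : Fin n → Obs p × Obs p) i => (z i).1) ⁻¹' (U (t₁ + t₂))) :=
        (hfst.measure_preimage (hUm _).nullMeasurableSet).symm
    _ ≤ (Measure.pi fun _ : Fin n => Q) (U t₁) + (Measure.pi fun _ : Fin n => π)
          {z | n * t₂ ≤ ∑ i, min 2 (B * ‖(z i).1 - (z i).2‖)} := by
        rw [← hsnd.measure_preimage (hUm t₁).nullMeasurableSet]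
        exact (measure_mono hcover).trans (measure_union_le _ _)
    _ ≤ _ := by
        refine (add_le_add hgauss htrans).trans (le_of_eq ?_)
        rw [← ENNReal.ofReal_add (by positivity) (by positivity), add_halves]

end WGAN

/-! ### The main theorem -/

theorem theorem15 :
    ∃ c : ℝ, 0 < c ∧ ∀ B₁ B₂ B₃ : ℝ, 0 < B₂ → ∃ C : ℝ, 0 < C ∧
      ∀ (p n L : ℕ) (d : ℕ → ℕ) (ε : ℝ), 0 < n → 1 ≤ L → (∀ j, 0 < d j) → 0 ≤ ε →
        (2 : ℝ) ^ L * ((p : ℝ) / n) + ε ^ 2 ≤ c →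
      ∀ (θ : WGAN.Param p) (S : Set (WGAN.Param p)),
        θ ∈ S → S ⊆ WGAN.paramSpace p B₁ B₂ B₃ →
      ∀ P : Measure (WGAN.Obs p), IsProbabilityMeasure P →
        WGAN.wasserstein P (WGAN.modelLaw θ) ≤ ENNReal.ofReal ε →
      ∀ (Ω : Type*) (_ : MeasurableSpace Ω) (μ : Measure Ω) (Z : Fin n → Ω → WGAN.Obs p),
        IsProbabilityMeasure μ → iIndepFun Z μ → (∀ i, HasLaw (Z i) P μ) →
      ∀ θhat : Ω → WGAN.Param p,
        (∀ ω, WGAN.IsEstimate (WGAN.discriminator (WGAN.Obs p) (B₁ + 1) d L) S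
          (fun i => Z i ω) (θhat ω)) →
        μ {ω | ¬ ‖θ.1 - (θhat ω).1‖ ^ 2 ≤ C * max ((2 : ℝ) ^ L * √((p : ℝ) / n)) ε}
          ≤ ENNReal.ofReal (Real.exp (-((p : ℝ) + n * ε ^ 2))) := by
  refine ⟨1, one_pos, fun B₁ B₂ B₃ hB₂ => ?_⟩
  obtain ⟨κ, hκ, hsep⟩ := WGAN.exists_firstLayer_separation B₁ B₂ B₃ hB₂
  set v := √(B₃ * (1 + B₁) ^ 2 + 1) with hv
  set T := 43 * (16 * (2 + 4 * v * (B₁ + 1 + 1))) + (8 * (B₁ + 1) + 3) with hT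
  -- `C` is chosen before any parameter is known to exist, so `B₁` may be negative and `T` too;
  -- `|T|` and `+ 1` keep `C` positive.
  refine ⟨2 * |T| / κ + 1, by positivity, ?_⟩
  intro p n L d ε hn hL hd hε hsmall θ S hθ hS P hP hW Ω _ μ Z hμ hind hlaw θhat hest
  set m := max ((2 : ℝ) ^ L * √((p : ℝ) / n)) ε with hm
  have hm0 : 0 ≤ m := hε.trans (le_max_right _ _)
  rcases Nat.eq_zero_or_pos p with rfl | hp
  · have : {ω | ¬ ‖θ.1 - (θhat ω).1‖ ^ 2 ≤ (2 * |T| / κ + 1) * m} = ∅ := by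
      ext ω
      rw [Set.mem_ofPred_eq, Set.mem_empty_iff_false, iff_false, not_not,
        Subsingleton.elim θ.1 (θhat ω).1, sub_self, norm_zero, zero_pow two_ne_zero]
      positivity
    rw [this, measure_empty]
    exact zero_le
  have hθΘ := hS hθ
  have hB₁ : 0 ≤ B₁ := (norm_nonneg _).trans hθΘ.1
  have hB : 0 ≤ B₁ + 1 := by linarith
  have hn' : (0 : ℝ) < n := Nat.cast_pos.2 hn
  set D := WGAN.discriminator (WGAN.Obs p) (B₁ + 1) d L with hD
  have hdev := WGAN.measure_contaminated_deviation_le hp hn hL hd hε hB (Real.sqrt_nonneg _) hsmall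
    (WGAN.modelLaw_exp_inner_le hθΘ) hW
  refine le_trans ?_ hdev
  have hU := WGAN.measurableSet_deviation (WGAN.modelLaw θ) hB d L (n := n) (T * m)
  rw [← (hind.hasLaw_pi hlaw).measure_eq hU]
  -- The failure event lies inside the measurable deviation event, so no measurability of `θhat` is
  -- required.
  refine measure_mono fun ω hω => ?_
  by_contra hcon
  refine hω ?_
  have hle : ∀ f ∈ D, (∑ i, f (Z i ω)) / n - ∫ x, f x ∂(WGAN.modelLaw θ) ≤ T * m := by
    intro f hf
    by_contra! h
    refine hcon ⟨f, hf, ?_⟩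
    rw [Finset.sum_sub_distrib, Finset.sum_const, Finset.card_univ, Fintype.card_fin, nsmul_eq_mul]
    have := mul_lt_mul_of_pos_left h hn'
    rwa [mul_sub, mul_div_cancel₀ _ hn'.ne'] at this
  obtain ⟨f, hf, hgap⟩ := hsep p θ hθΘ (θhat ω) (hS (hest ω).1)
  have h2 := WGAN.sub_integral_le_of_isEstimate hn hB hθ (hest ω) hle
    (WGAN.firstLayer_subset_discriminator hd hL hf)
  have h3 : T * m ≤ |T| * m := mul_le_mul_of_nonneg_right (le_abs_self T) hm0
  have h4 : ‖θ.1 - (θhat ω).1‖ ^ 2 ≤ 2 * |T| / κ * m := by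
    rw [div_mul_eq_mul_div, le_div_iff₀ hκ]
    linarith
  linarith
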